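/- Let $n\ge 1$ and $\varepsilon>0$. Let $P(z)=z_1^2+\cdots+z_{n+1}^2$ on $\mathbb{C}^{n+1}$, let $\mathbb{S}=\mathbb{S}^{2n+1}_\varepsilon=\{z\in\mathbb{C}^{n+1} : |z|=\varepsilon\}$, $K=\{z\in\mathbb{S} : P(z)=0\}$, and $\Theta:\mathbb{S}\setminus K\to S^1\subset\mathbb{C}$, $\Theta(z)=P(z)/|P(z)|$. Let $\psi_0(z)=|z|^2$, let $J_0$ be multiplication by $i$ (so that $(J_0,\psi_0)$ is the standard Stein structure on $\mathbb{C}^{n+1}$, and hence on the ball $\{|z|\le\varepsilon\}$), and let $$\alpha_0=-\tfrac14\, d\psi_0\circ J_0=\tfrac12\sum_{j=1}^{n+1}(x_j\,dy_j-y_j\,dx_j),\qquad z_j=x_j+iy_j .$$ Then $\mathcal{OB}=(K,\Theta)$ is an open book on $\mathbb{S}$, $\alpha_0|_{\mathbb{S}}$ is a contact form, and $\mathcal{OB}$ carries the standard contact structure $\xi_0=\mathrm{Ker}(\alpha_0|_{\mathbb{S}})$ by means of $\alpha_0$. Explicitly: * (Open book.) $\mathbb{S}$ is a closed smooth manifold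 of dimension $2n+1$; $K\subset\mathbb{S}$ is a closed smooth submanifold of dimension $2n-1$; $\Theta$ is a smooth locally trivial fibration of $\mathbb{S}\setminus K$ onto $S^1$; and there is a diffeomorphism from $K\times\{w\in\mathbb{C}:|w|<1\}$ onto an open neighbourhood of $K$ in $\mathbb{S}$, which maps $(b,0)$ to $b$, under which $\Theta$ becomes $(b,w)\mapsto w/|w|$ for $w\ne 0$. * (Contact form.) $\alpha_0\wedge(d\alpha_0)^n$ vanishes nowhere on $\mathbb{S}$. * (i) $(K,\alpha_0|_{TK})$ is a contact manifold: $\alpha_0\wedge(d\alpha_0)^{n-1}$ vanishes nowhere on $K$. * (ii) For every $t\in S^1$ the page $X_t=\Theta^{-1}(t)$ is a $2n$-dimensional manifold on which $d\alpha_0$ is a symplectic form. * (iii) For every $t\in S^1$, the orientation of $K$ given by $\alpha_0\wedge(d\alpha_0)^{n-1}$ coincides with its orientation as the boundary (outward normal first) of the closure $\overline{X_t}$ of $X_t$ in $\mathbb{S}$, where $\overline{X_t}$ is oriented by the continuous extension of the orientation of $X_t$ given by $(d\alpha_0)^n$. -/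

import Mathlib

open Set Filter Topology
open scoped ContDiff

noncomputable section

namespace ContactOpenBook

/-! ### Embedded submanifolds, smooth maps between them, differential forms -/

section General

variable {E : Type*} [NormedAddCommGroup E] [NormedSpace ℝ E]
variable {E' : Type*} [NormedAddCommGroup E'] [NormedSpace ℝ E']

/-- `M` is a smooth embedded submanifold (without boundary) of dimension `d` of the
finite-dimensional space `E`: near each of its points it is the zero set of a smooth submersion. -/
def IsSubmanifold (d : ℕ) (M : Set E) : Prop :=
  ∃ c : ℕ, c + d = Module.finrank ℝ E ∧
    ∀ x ∈ M, ∃ (U : Set E) (F : E → (Fin c → ℝ)), IsOpen U ∧ x ∈ U ∧ ContDiffOn ℝ ∞ F U ∧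
      Function.Surjective (fderiv ℝ F x) ∧ M ∩ U = {y | y ∈ U ∧ F y = 0}

/-- The tangent space of `M` at `x`: velocities at time `0` of smooth curves in `M` through `x`. -/
def tangentSpace (M : Set E) (x : E) : Set E :=
  {v | ∃ (γ : ℝ → E) (δ : ℝ), 0 < δ ∧ ContDiffOn ℝ ∞ γ (Ioo (-δ) δ) ∧
    (∀ t ∈ Ioo (-δ) δ, γ t ∈ M) ∧ γ 0 = x ∧ HasDerivAt γ v 0}

/-- `Φ` restricts to a diffeomorphism from `s` onto `t` (both smooth in the sense of subsets of
normed spaces, that is, locally the maps have smooth extensions). -/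
def IsDiffeoOn (Φ : E → E') (s : Set E) (t : Set E') : Prop :=
  ContDiffOn ℝ ∞ Φ s ∧ MapsTo Φ s t ∧
    ∃ Ψ : E' → E, ContDiffOn ℝ ∞ Ψ t ∧ MapsTo Ψ t s ∧ InvOn Ψ Φ s t

/-- The wedge product of two alternating forms (sum over shuffles). -/
def wedge {k l : ℕ} (a : E [⋀^Fin k]→ₗ[ℝ] ℝ) (b : E [⋀^Fin l]→ₗ[ℝ] ℝ) :
    E [⋀^Fin (k + l)]→ₗ[ℝ] ℝ :=
  ((LinearMap.mul' ℝ ℝ).compAlternatingMap (a.domCoprod b)).domDomCongr finSumFinEquiv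

/-- The wedge power `σ ∧ ⋯ ∧ σ` (`n` factors) of a two-form. -/
def wedgePow (σ : E [⋀^Fin 2]→ₗ[ℝ] ℝ) : (n : ℕ) → E [⋀^Fin (2 * n)]→ₗ[ℝ] ℝ
  | 0 => AlternatingMap.constOfIsEmpty ℝ E (Fin 0) 1
  | n + 1 => wedge (wedgePow σ n) σ

/-- `(dα)^k` at the point `x`. -/
def dPow (α : E → E [⋀^Fin 1]→L[ℝ] ℝ) (k : ℕ) (x : E) : E [⋀^Fin (2 * k)]→ₗ[ℝ] ℝ :=
  wedgePow (extDeriv α x).toAlternatingMap k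

/-- The form `α ∧ (dα)^k` at the point `x`, written as `(dα)^k ∧ α`, which is the same form
because `(dα)^k` has even degree. -/
def contactVolume (α : E → E [⋀^Fin 1]→L[ℝ] ℝ) (k : ℕ) (x : E) :
    E [⋀^Fin (2 * k + 1)]→ₗ[ℝ] ℝ :=
  wedge (dPow α k x) (α x).toAlternatingMap

/-- `(M, α|_{TM})` is a contact manifold of dimension `2k+1`: `M` is a submanifold of that
dimension, and the restriction to `M` of the smooth one-form `α` is a contact form, that is,
`α ∧ (dα)^k` vanishes at no point of `M` as a form on the tangent space of `M`. -/
structure IsContactForm (k : ℕ) (M : Set E) (α : E → E [⋀^Fin 1]→L[ℝ] ℝ) : Prop where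
  submanifold : IsSubmanifold (2 * k + 1) M
  smooth : ContDiff ℝ ∞ α
  nonvanishing : ∀ x ∈ M, ∃ v : Fin (2 * k + 1) → E,
    (∀ i, v i ∈ tangentSpace M x) ∧ contactVolume α k x v ≠ 0

/-- `X` is a submanifold of dimension `2k`, and the restriction of `σ` to `X` is a symplectic
form. -/
structure IsSymplecticForm (k : ℕ) (X : Set E) (σ : E → E [⋀^Fin 2]→L[ℝ] ℝ) : Prop where
  submanifold : IsSubmanifold (2 * k) X
  smooth : ContDiff ℝ ∞ σ
  closed : ∀ x ∈ X, ∀ v : Fin 3 → E, (∀ i, v i ∈ tangentSpace X x) → extDeriv σ x v = 0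
  nondegenerate : ∀ x ∈ X, ∀ v ∈ tangentSpace X x, v ≠ 0 →
    ∃ w ∈ tangentSpace X x, σ x ![v, w] ≠ 0

/-! ### Open books and contact structures carried by them -/

/-- The (open) page of `(B, f)` over `t`. -/
def page (M B : Set E) (f : E → ℂ) (t : ℂ) : Set E := {x | x ∈ M \ B ∧ f x = t}

/-- `(B, f)` is an open book with binding `B` on the closed manifold `M` of dimension `d + 2`:
`B` is a closed submanifold of codimension two, `f : M \ B → S¹` is a smooth locally trivial
fibration, and `B` has a tubular neighbourhood `B × D²` in `M` (`D²` the open unit disk) in which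
`B` is `B × 0` and `f` is the angular coordinate of `D²`. -/
structure IsOpenBook (d : ℕ) (M B : Set E) (f : E → ℂ) : Prop where
  compact : IsCompact M
  submanifold : IsSubmanifold (d + 2) M
  binding_subset : B ⊆ M
  binding_closed : IsClosed B
  binding_submanifold : IsSubmanifold d B
  smooth : ContDiffOn ℝ ∞ f (M \ B)
  mapsTo : MapsTo f (M \ B) (Metric.sphere (0 : ℂ) 1)
  surjOn : SurjOn f (M \ B) (Metric.sphere (0 : ℂ) 1)
  locallyTrivial : ∀ t₀ ∈ Metric.sphere (0 : ℂ) 1, ∃ (U : Set ℂ) (Φ : ℂ × E → E),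
    IsOpen U ∧ t₀ ∈ U ∧
    IsDiffeoOn Φ ((U ∩ Metric.sphere (0 : ℂ) 1) ×ˢ page M B f t₀) ((M \ B) ∩ f ⁻¹' U) ∧
    ∀ t ∈ U ∩ Metric.sphere (0 : ℂ) 1, ∀ x ∈ page M B f t₀, f (Φ (t, x)) = t
  tubular : ∃ (O : Set E) (Φ : E × ℂ → E), IsOpen O ∧
    IsDiffeoOn Φ (B ×ˢ Metric.ball (0 : ℂ) 1) (M ∩ O) ∧
    (∀ b ∈ B, Φ (b, 0) = b) ∧
    ∀ b ∈ B, ∀ w ∈ Metric.ball (0 : ℂ) 1, w ≠ 0 →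
      Φ (b, w) ∉ B ∧ f (Φ (b, w)) = w / (‖w‖ : ℂ)

/-- `ν` is an outward pointing tangent vector at the boundary point `b ∈ B` of the manifold with
boundary `closure X`, whose boundary is `B`: it is not tangent to `B`, and it is the final velocity
of a smooth curve in `closure X` that ends at `b`. -/
def IsOutward (X B : Set E) (b ν : E) : Prop :=
  ν ∉ tangentSpace B b ∧
  ∃ (γ : ℝ → E) (δ : ℝ), 0 < δ ∧ ContDiffOn ℝ ∞ γ (Icc (-δ) 0) ∧
    (∀ t ∈ Icc (-δ) 0, γ t ∈ closure X) ∧ γ 0 = b ∧ HasDerivWithinAt γ ν (Iic 0) 0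

/-- The orientation of `B` (of dimension `2k+1`) by the volume form `α ∧ (dα)^k` coincides with its
orientation as the boundary of `closure X`, where `X` is oriented by `(dα)^(k+1)`.

With the outward normal first, this says that if `v` is a frame of `T_b B` which is positive for
`α ∧ (dα)^k`, and `ν` is outward pointing at `b`, then `(ν, v)` is a positive frame of `closure X`
at `b`. The form `dα` is symplectic on the interior `X` only (it may degenerate along `B`), so the
orientation of `closure X` at `b` is the extension by continuity of that of `X`: the frames of `X`
that are close enough to the frame `(ν, v)` at `b` are positive for `(dα)^(k+1)`. -/
def BoundaryOrientationAgrees (k : ℕ) (X B : Set E) (α : E → E [⋀^Fin 1]→L[ℝ] ℝ) : Prop :=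
  ∀ b ∈ B, ∀ ν : E, IsOutward X B b ν →
    ∀ v : Fin (2 * k + 1) → E, (∀ i, v i ∈ tangentSpace B b) → 0 < contactVolume α k b v →
      ∀ᶠ p : E × (Fin (2 * (k + 1)) → E) in
        𝓝[{p | p.1 ∈ X ∧ ∀ i, p.2 i ∈ tangentSpace X p.1}]
          (b, (Fin.cons ν v : Fin (2 * k + 1 + 1) → E)),
        0 < dPow α (k + 1) p.1 p.2

/-- The contact structure `ξ = Ker α` on `M` is carried by the open book `(B, f)` on `M`, by means
of the contact form `α`. Here `B`, the pages, and `M` have dimensions `2k+1`, `2k+2`, `2k+3`. -/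
structure CarriesKer (k : ℕ) (M B : Set E) (f : E → ℂ) (α : E → E [⋀^Fin 1]→L[ℝ] ℝ) :
    Prop where
  openBook : IsOpenBook (2 * k + 1) M B f
  contact : IsContactForm (k + 1) M α
  binding_contact : IsContactForm k B α
  page_symplectic : ∀ t ∈ Metric.sphere (0 : ℂ) 1,
    IsSymplecticForm (k + 1) (page M B f t) (extDeriv α)
  orientation : ∀ t ∈ Metric.sphere (0 : ℂ) 1,
    BoundaryOrientationAgrees k (page M B f t) B α

end General

/-! ### The Milnor open book of `z₁² + ⋯ + z_{n+1}²` and the standard contact form -/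

/-- `ℂ^{n+1}` with its Euclidean norm. -/
abbrev Cn (n : ℕ) : Type := EuclideanSpace ℂ (Fin (n + 1))

/-- `P(z) = z₁² + ⋯ + z_{n+1}²`. -/
def P (n : ℕ) (z : Cn n) : ℂ := ∑ j, z j ^ 2

/-- The binding `K = Z(P) ∩ S_ε`. -/
def K (n : ℕ) (ε : ℝ) : Set (Cn n) := {z | z ∈ Metric.sphere (0 : Cn n) ε ∧ P n z = 0}

/-- `Θ(z) = P(z) / |P(z)|`. -/
def Θ (n : ℕ) (z : Cn n) : ℂ := P n z / (‖P n z‖ : ℂ)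

/-- The standard complex structure `J₀` on `ℂ^{n+1}` (multiplication by `i`). -/
def J₀ (n : ℕ) : Cn n →L[ℝ] Cn n :=
  (Complex.I • ContinuousLinearMap.id ℂ (Cn n)).restrictScalars ℝ

/-- The plurisubharmonic function `ψ₀(z) = |z|²` of the standard Stein structure `(J₀, ψ₀)`. -/
def ψ₀ (n : ℕ) (z : Cn n) : ℝ := ‖z‖ ^ 2

/-- The standard contact form `α₀ = -(1/4) dψ₀ ∘ J₀`, which is `½ ∑ⱼ (xⱼ dyⱼ - yⱼ dxⱼ)` by
`α₀_apply` below. Its kernel on the sphere is the standard contact structure `ξ₀`. -/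
def α₀ (n : ℕ) (z : Cn n) : Cn n [⋀^Fin 1]→L[ℝ] ℝ :=
  ContinuousAlternatingMap.ofSubsingleton ℝ (Cn n) ℝ (0 : Fin 1)
    (-(1 / 4 : ℝ) • (fderiv ℝ (ψ₀ n) z).comp (J₀ n))

/-- `α₀ = ½ ∑ⱼ (xⱼ dyⱼ - yⱼ dxⱼ)`. -/
theorem α₀_apply (n : ℕ) (z v : Cn n) :
    α₀ n z ![v] = (1 / 2 : ℝ) * ∑ j, ((z j).re * (v j).im - (z j).im * (v j).re) := by
  have hre : ∀ j, HasFDerivAt (fun z : Cn n => (z j).re)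
      (Complex.reCLM.comp ((EuclideanSpace.proj j : Cn n →L[ℂ] ℂ).restrictScalars ℝ)) z :=
    fun j => (Complex.reCLM.comp
      ((EuclideanSpace.proj j : Cn n →L[ℂ] ℂ).restrictScalars ℝ)).hasFDerivAt
  have him : ∀ j, HasFDerivAt (fun z : Cn n => (z j).im)
      (Complex.imCLM.comp ((EuclideanSpace.proj j : Cn n →L[ℂ] ℂ).restrictScalars ℝ)) z :=
    fun j => (Complex.imCLM.comp
      ((EuclideanSpace.proj j : Cn n →L[ℂ] ℂ).restrictScalars ℝ)).hasFDerivAt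
  have hψ : ψ₀ n = fun z => ∑ j, ((z j).re * (z j).re + (z j).im * (z j).im) := by
    funext z
    simp only [ψ₀, EuclideanSpace.norm_sq_eq, Complex.sq_norm, Complex.normSq_apply]
  have h := HasFDerivAt.fun_sum (u := Finset.univ)
    fun j _ => ((hre j).mul (hre j)).add ((him j).mul (him j))
  have h' := h.congr_of_eventuallyEq (f₁ := ψ₀ n) (Filter.Eventually.of_forall fun y => by rw [hψ]; rfl)
  simp only [α₀, h'.fderiv]
  simp only [Finset.mul_sum]
  simp [J₀, Finset.mul_sum]
  rw [← Finset.sum_neg_distrib]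
  refine Finset.sum_congr rfl fun j _ => ?_
  ring

end ContactOpenBook

end

/-! Write ⟨·,·⟩ for the Hermitian product, conjugate-linear in the first slot, z̄ for the
coordinatewise conjugate, and σ = Im⟨·,·⟩. Then P(z) = ⟨z̄, z⟩, the form α₀ at z is ½σ(z, ·), and
dα₀ is the constant form σ. Everything reduces to linear algebra with z, iz and z̄. Volume forms are
evaluated on adapted frames by the rule that contracting σ^(n+1) with u gives (n+1) σ(u, ·) ∧ σ^n
(`curryLeft_twoPow_succ`).

Contact conditions: on vectors tangent to the sphere, σ(iz, ·) vanishes, while α₀(iz) = ½|z|² > 0.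
The complex orthogonal complement of z (for the sphere) or of z and z̄ (for K) carries a frame on
which the power of σ is positive (`exists_twoPow_pos`).

Pages: on X_t the number q = t̄P is real and positive, and d(Im t̄P)(iz) = 2q, so iz is transverse
to X_t. A vector of TX_t that is σ-orthogonal to TX_t turns out to be a multiple of iz, hence zero
(`eq_zero_of_sympl_eq_zero`).

Orientation: up to a positive constant, (dα₀)^n on X_t is q times α₀ ∧ σ^n with Y = itz̄ inserted
(`dPow_eq_contactVolume_cons`). The factor q tends to 0 at K, but the other factor is continuous
there, and at b in K its value on (ν, v) is a positive multiple of σ(Y, ν) times the contact volume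
of v. An outward ν has σ(Y, ν) > 0.

Open book: P(cz) = c²P(z), so unit scalars permute the pages and a local square root trivialises Θ.
On K the vectors b and b̄ are orthogonal of equal length, so (b + w b̄)/√(1+|w|²) stays on the
sphere, and P takes there the value ε²·2w/(1+|w|²), which has the phase of w. -/

noncomputable section

namespace ContactOpenBook

/-! ### Exterior algebra: products with one- and two-forms -/

section Exterior

open AlternatingMap

variable {E : Type*} [AddCommGroup E] [Module ℝ E] {k : ℕ}

/-- The exterior product `θ ∧ a` of a one-form `θ` with a `k`-form `a`. -/
def oneWedge (θ : E →ₗ[ℝ] ℝ) (a : E [⋀^Fin k]→ₗ[ℝ] ℝ) : E [⋀^Fin (k + 1)]→ₗ[ℝ] ℝ :=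
  alternatizeUncurryFin (LinearMap.toSpanSingleton ℝ _ a ∘ₗ θ)

/-- The exterior product `σ ∧ a` of a two-form, given as a bilinear map, with a `k`-form `a`. -/
def twoWedge (σ : E →ₗ[ℝ] E →ₗ[ℝ] ℝ) (a : E [⋀^Fin k]→ₗ[ℝ] ℝ) : E [⋀^Fin (k + 2)]→ₗ[ℝ] ℝ :=
  (1 / 2 : ℝ) • alternatizeUncurryFin
    (alternatizeUncurryFinLM ∘ₗ σ.compr₂ (LinearMap.toSpanSingleton ℝ _ a))

/-- The exterior power `σ ∧ ⋯ ∧ σ` of a two-form, given as a bilinear map. -/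
def twoPow (σ : E →ₗ[ℝ] E →ₗ[ℝ] ℝ) : (n : ℕ) → E [⋀^Fin (2 * n)]→ₗ[ℝ] ℝ
  | 0 => AlternatingMap.constOfIsEmpty ℝ E (Fin 0) 1
  | n + 1 => twoWedge σ (twoPow σ n)

theorem oneWedge_apply (θ : E →ₗ[ℝ] ℝ) (a : E [⋀^Fin k]→ₗ[ℝ] ℝ) (v : Fin (k + 1) → E) :
    oneWedge θ a v = ∑ i : Fin (k + 1), (-1 : ℝ) ^ (i : ℕ) * (θ (v i) * a (i.removeNth v)) := by
  simp only [oneWedge, alternatizeUncurryFin_apply]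
  refine Finset.sum_congr rfl fun i _ => ?_
  simp [zsmul_eq_mul]

/-- The factor 1/2 is there because alternating twice meets each pair of arguments of an
antisymmetric σ in both orders. -/
theorem twoWedge_apply (σ : E →ₗ[ℝ] E →ₗ[ℝ] ℝ) (a : E [⋀^Fin k]→ₗ[ℝ] ℝ)
    (v : Fin (k + 2) → E) :
    twoWedge σ a v =
      1 / 2 * ∑ i : Fin (k + 2), (-1 : ℝ) ^ (i : ℕ) * oneWedge (σ (v i)) a (i.removeNth v) := by
  simp only [twoWedge, AlternatingMap.smul_apply, alternatizeUncurryFin_apply, smul_eq_mul]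
  congr 1
  refine Finset.sum_congr rfl fun i _ => ?_
  rw [zsmul_eq_mul]
  push_cast
  rfl

theorem oneWedge_add (θ : E →ₗ[ℝ] ℝ) (a b : E [⋀^Fin k]→ₗ[ℝ] ℝ) :
    oneWedge θ (a + b) = oneWedge θ a + oneWedge θ b := by
  ext v; simp [oneWedge_apply, mul_add, Finset.sum_add_distrib]

theorem oneWedge_smul (θ : E →ₗ[ℝ] ℝ) (c : ℝ) (a : E [⋀^Fin k]→ₗ[ℝ] ℝ) :
    oneWedge θ (c • a) = c • oneWedge θ a := by
  ext v
  simp only [oneWedge_apply, AlternatingMap.smul_apply, smul_eq_mul, Finset.mul_sum]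
  exact Finset.sum_congr rfl fun i _ => by ring

theorem oneWedge_sub (θ : E →ₗ[ℝ] ℝ) (a b : E [⋀^Fin k]→ₗ[ℝ] ℝ) :
    oneWedge θ (a - b) = oneWedge θ a - oneWedge θ b := by
  ext v; simp [oneWedge_apply, mul_sub, Finset.sum_sub_distrib]

theorem twoWedge_smul (σ : E →ₗ[ℝ] E →ₗ[ℝ] ℝ) (c : ℝ) (a : E [⋀^Fin k]→ₗ[ℝ] ℝ) :
    twoWedge σ (c • a) = c • twoWedge σ a := by
  ext v
  simp only [twoWedge_apply, oneWedge_smul, AlternatingMap.smul_apply, smul_eq_mul,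
    Finset.mul_sum]
  exact Finset.sum_congr rfl fun i _ => by ring

theorem twoWedge_sub (σ : E →ₗ[ℝ] E →ₗ[ℝ] ℝ) (a b : E [⋀^Fin k]→ₗ[ℝ] ℝ) :
    twoWedge σ (a - b) = twoWedge σ a - twoWedge σ b := by
  ext v
  simp [twoWedge_apply, oneWedge_sub, mul_sub, Finset.sum_sub_distrib]

theorem oneWedge_eq_zero (θ : E →ₗ[ℝ] ℝ) (a : E [⋀^Fin k]→ₗ[ℝ] ℝ) {v : Fin (k + 1) → E}
    (h : ∀ i, θ (v i) = 0) : oneWedge θ a v = 0 := by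
  simp [oneWedge_apply, h]

/-- Reduces identities between forms to their contractions, which makes induction on the degree
possible. -/
theorem eq_of_curryLeft_eq {a b : E [⋀^Fin (k + 1)]→ₗ[ℝ] ℝ}
    (h : ∀ u, a.curryLeft u = b.curryLeft u) : a = b := by
  ext v
  have := congrArg (fun c => c (Fin.tail v)) (h (v 0))
  simp only [AlternatingMap.curryLeft_apply_apply, Matrix.vecCons, Fin.cons_self_tail] at this
  exact this

theorem curryLeft_neg_apply (a : E [⋀^Fin (k + 1)]→ₗ[ℝ] ℝ) (u : E) :
    (-a).curryLeft u = -a.curryLeft u := rfl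

theorem removeNth_succ_cons {E : Type*} (u : E) (v : Fin (k + 1) → E) (i : Fin (k + 1)) :
    i.succ.removeNth (Fin.cons u v : Fin (k + 2) → E) = Fin.cons u (i.removeNth v) := by
  funext j
  refine Fin.cases ?_ (fun j => ?_) j
  · simp [Fin.removeNth_apply]
  · simp [Fin.removeNth_apply]

theorem curryLeft_oneWedge (θ : E →ₗ[ℝ] ℝ) (a : E [⋀^Fin (k + 1)]→ₗ[ℝ] ℝ) (u : E) :
    (oneWedge θ a).curryLeft u = θ u • a - oneWedge θ (a.curryLeft u) := by
  ext v
  simp only [curryLeft_apply_apply, oneWedge_apply, Matrix.vecCons, AlternatingMap.sub_apply,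
    AlternatingMap.smul_apply, smul_eq_mul]
  rw [Fin.sum_univ_succ, sub_eq_add_neg, ← Finset.sum_neg_distrib]
  congr 1
  · simp [Fin.removeNth_zero]
  · refine Finset.sum_congr rfl fun i _ => ?_
    rw [removeNth_succ_cons]
    simp only [Fin.cons_succ, Fin.val_succ, pow_succ]
    ring

theorem curryLeft_oneWedge_zero (θ : E →ₗ[ℝ] ℝ) (a : E [⋀^Fin 0]→ₗ[ℝ] ℝ) (u : E) :
    (oneWedge θ a).curryLeft u = θ u • a := by
  ext v
  simp [curryLeft_apply_apply, oneWedge_apply, Matrix.vecCons, Fin.removeNth_zero]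

/-- Contraction is an antiderivation, and the sign is + since σ has even degree. The terms with u in
the first and in the second slot of σ agree by antisymmetry, and together they cancel the 1/2. -/
theorem curryLeft_twoWedge {σ : E →ₗ[ℝ] E →ₗ[ℝ] ℝ} (hσ : ∀ x y, σ x y = -σ y x)
    (a : E [⋀^Fin (k + 1)]→ₗ[ℝ] ℝ) (u : E) :
    (twoWedge σ a).curryLeft u = oneWedge (σ u) a + twoWedge σ (a.curryLeft u) := by
  ext v
  have key : ∀ i : Fin (k + 2), oneWedge (σ (v i)) a (Fin.cons u (i.removeNth v))
      = σ (v i) u * a (i.removeNth v) - oneWedge (σ (v i)) (a.curryLeft u) (i.removeNth v) := by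
    intro i
    exact congrArg (fun c => c (i.removeNth v)) (curryLeft_oneWedge (σ (v i)) a u)
  simp only [curryLeft_apply_apply, twoWedge_apply, Matrix.vecCons, AlternatingMap.add_apply]
  rw [Fin.sum_univ_succ]
  simp only [Fin.cons_zero, Fin.cons_succ, removeNth_succ_cons, key, Fin.removeNth_zero,
    Fin.tail_cons, Fin.val_zero, pow_zero, one_mul, Fin.val_succ, pow_succ]
  rw [oneWedge_apply (σ u) a v]
  simp only [hσ _ u]
  simp only [mul_sub, Finset.sum_sub_distrib, mul_neg, neg_mul, mul_one, Finset.sum_neg_distrib,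
    mul_add]
  ring

theorem curryLeft_twoWedge_zero {σ : E →ₗ[ℝ] E →ₗ[ℝ] ℝ} (hσ : ∀ x y, σ x y = -σ y x)
    (a : E [⋀^Fin 0]→ₗ[ℝ] ℝ) (u : E) :
    (twoWedge σ a).curryLeft u = oneWedge (σ u) a := by
  ext v
  simp [curryLeft_apply_apply, twoWedge_apply, Matrix.vecCons, oneWedge_apply, Fin.removeNth,
    hσ (v 0) u, Subsingleton.elim (α := Fin 0 → E) _ ![]]
  ring

theorem oneWedge_oneWedge (θ φ : E →ₗ[ℝ] ℝ) : ∀ {k : ℕ} (a : E [⋀^Fin k]→ₗ[ℝ] ℝ),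
    oneWedge θ (oneWedge φ a) = -oneWedge φ (oneWedge θ a)
  | 0, a => by
    refine eq_of_curryLeft_eq fun u => ?_
    rw [curryLeft_neg_apply]
    simp only [curryLeft_oneWedge, curryLeft_oneWedge_zero, oneWedge_smul]
    abel
  | k + 1, a => by
    refine eq_of_curryLeft_eq fun u => ?_
    rw [curryLeft_neg_apply]
    simp only [curryLeft_oneWedge, oneWedge_smul, oneWedge_sub]
    rw [oneWedge_oneWedge θ φ (a.curryLeft u)]
    abel

theorem twoWedge_oneWedge {σ : E →ₗ[ℝ] E →ₗ[ℝ] ℝ} (hσ : ∀ x y, σ x y = -σ y x)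
    (θ : E →ₗ[ℝ] ℝ) : ∀ {k : ℕ} (a : E [⋀^Fin k]→ₗ[ℝ] ℝ),
    twoWedge σ (oneWedge θ a) = oneWedge θ (twoWedge σ a)
  | 0, a => by
    refine eq_of_curryLeft_eq fun u => ?_
    simp only [curryLeft_twoWedge hσ, curryLeft_oneWedge, curryLeft_oneWedge_zero,
      curryLeft_twoWedge_zero hσ, twoWedge_smul]
    rw [oneWedge_oneWedge (σ u)]
    abel
  | k + 1, a => by
    refine eq_of_curryLeft_eq fun u => ?_
    simp only [curryLeft_twoWedge hσ, curryLeft_oneWedge, twoWedge_smul, twoWedge_sub,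
      oneWedge_add]
    rw [twoWedge_oneWedge hσ θ (a.curryLeft u), oneWedge_oneWedge (σ u)]
    abel

/-- The power rule for a derivation: the one-form σ(u, ·) commutes past the remaining factors σ, so
the n + 1 contributions coincide. -/
theorem curryLeft_twoPow_succ {σ : E →ₗ[ℝ] E →ₗ[ℝ] ℝ} (hσ : ∀ x y, σ x y = -σ y x) (u : E) :
    ∀ n : ℕ, AlternatingMap.curryLeft (n := 2 * n + 1) (twoPow σ (n + 1)) u =
      ((n : ℝ) + 1) • oneWedge (σ u) (twoPow σ n)
  | 0 => by
    refine (curryLeft_twoWedge_zero hσ _ u).trans ?_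
    simp
  | n + 1 => by
    refine (curryLeft_twoWedge (k := 2 * n + 1) hσ (twoPow σ (n + 1)) u).trans ?_
    rw [curryLeft_twoPow_succ hσ u n, twoWedge_smul, twoWedge_oneWedge hσ]
    change oneWedge (σ u) (twoPow σ (n + 1)) + _ • oneWedge (σ u) (twoPow σ (n + 1)) = _
    push_cast
    module

theorem oneWedge_cons (θ : E →ₗ[ℝ] ℝ) (a : E [⋀^Fin k]→ₗ[ℝ] ℝ) (u : E) {v : Fin k → E}
    (h : ∀ i, θ (v i) = 0) : oneWedge θ a (Fin.cons u v : Fin (k + 1) → E) = θ u * a v := by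
  simp [oneWedge_apply, Fin.sum_univ_succ, h, Fin.removeNth_zero]

theorem apply_cons (a : E [⋀^Fin (k + 1)]→ₗ[ℝ] ℝ) (u : E) (v : Fin k → E) :
    a (Fin.cons u v : Fin (k + 1) → E) = a.curryLeft u v := rfl

theorem twoPow_cons_cons {σ : E →ₗ[ℝ] E →ₗ[ℝ] ℝ} (hσ : ∀ x y, σ x y = -σ y x) (n : ℕ)
    (u w : E) {v : Fin (2 * n) → E} (h : ∀ i, σ u (v i) = 0) :
    twoPow σ (n + 1) (Fin.cons u (Fin.cons w v : Fin (2 * n + 1) → E) : Fin (2 * n + 1 + 1) → E) =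
      (n + 1) * σ u w * twoPow σ n v := by
  refine (apply_cons (k := 2 * n + 1) _ u _).trans ?_
  rw [curryLeft_twoPow_succ hσ, AlternatingMap.smul_apply, oneWedge_cons _ _ _ h, smul_eq_mul,
    mul_assoc]

theorem oneWedge_twoPow_cons {σ : E →ₗ[ℝ] E →ₗ[ℝ] ℝ} (hσ : ∀ x y, σ x y = -σ y x)
    (θ : E →ₗ[ℝ] ℝ) (n : ℕ) (u : E) {v : Fin (2 * n) → E} (h : ∀ i, σ u (v i) = 0) :
    oneWedge θ (twoPow σ n) (Fin.cons u v : Fin (2 * n + 1) → E) = θ u * twoPow σ n v := by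
  cases n with
  | zero => rw [apply_cons, curryLeft_oneWedge_zero]; rfl
  | succ n =>
    refine (apply_cons (k := 2 * n + 1 + 1) _ u _).trans ?_
    rw [curryLeft_oneWedge, curryLeft_twoPow_succ hσ, oneWedge_smul, oneWedge_oneWedge,
      AlternatingMap.sub_apply, AlternatingMap.smul_apply, AlternatingMap.smul_apply,
      AlternatingMap.neg_apply, oneWedge_eq_zero _ _ h]
    simp

/-- In this frame u pairs only with w, so the pair (u, w) splits off. At the binding this compares
the orientations, with u = itz̄ and w outward. -/
theorem oneWedge_twoPow_cons_cons {σ : E →ₗ[ℝ] E →ₗ[ℝ] ℝ} (hσ : ∀ x y, σ x y = -σ y x)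
    (θ : E →ₗ[ℝ] ℝ) (n : ℕ) (u w : E) {v : Fin (2 * n + 1) → E} (hu : θ u = 0)
    (h : ∀ i, σ u (v i) = 0) :
    oneWedge θ (twoPow σ (n + 1))
        (Fin.cons u (Fin.cons w v : Fin (2 * n + 1 + 1) → E) : Fin (2 * n + 1 + 1 + 1) → E) =
      (n + 1) * σ u w * oneWedge θ (twoPow σ n) v := by
  refine (apply_cons (k := 2 * n + 1 + 1) _ u _).trans ?_
  rw [curryLeft_oneWedge, curryLeft_twoPow_succ hσ, oneWedge_smul, oneWedge_oneWedge, hu,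
    AlternatingMap.sub_apply, AlternatingMap.smul_apply, AlternatingMap.smul_apply,
    AlternatingMap.neg_apply, oneWedge_cons _ _ _ h]
  simp
  ring

end Exterior

/-! ### Comparison of the shuffle wedge product with `oneWedge` and `twoWedge`. -/

section WedgeComparison

open Equiv

variable {E : Type*} [NormedAddCommGroup E] [NormedSpace ℝ E] {k : ℕ}

/-- Expansion of an alternating sum over permutations along the image of `0`. -/
theorem sum_perm_succ {X : Type*} (g : X → (Fin k → X) → ℝ) (v : Fin (k + 1) → X) :
    ∑ π : Perm (Fin (k + 1)), (Perm.sign π : ℝ) * g (v (π 0)) (fun i => v (π i.succ)) =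
      ∑ p : Fin (k + 1), (-1 : ℝ) ^ (p : ℕ) *
        ∑ ρ : Perm (Fin k), (Perm.sign ρ : ℝ) * g (v p) (fun i => p.removeNth v (ρ i)) := by
  rw [← Perm.decomposeFin.symm.sum_comp, Fintype.sum_prod_type]
  refine Finset.sum_congr rfl fun p _ => ?_
  refine Fin.cases ?_ (fun j => ?_) p
  · simp [Fin.removeNth_apply, Perm.decomposeFin.symm_sign]
  -- `decomposeFin` swaps 0 and j + 1, so it does not list the remaining indices in increasing
  -- order. The cycle corrects this; its sign (-1)^j and the sign -1 of the swap give (-1)^(j+1).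
  · rw [← Equiv.sum_comp (Equiv.mulLeft (Fin.cycleRange j)) fun ρ : Perm (Fin k) =>
      (Perm.sign ρ : ℝ) * g (v j.succ) fun i => j.succ.removeNth v (ρ i), Finset.mul_sum]
    refine Finset.sum_congr rfl fun ρ _ => ?_
    have hv : ∀ i, v (Perm.decomposeFin.symm (j.succ, ρ) i.succ) =
        j.succ.removeNth v (j.cycleRange (ρ i)) := by
      intro i
      rw [Perm.decomposeFin_symm_apply_succ, Fin.removeNth_apply, Fin.succAbove_cycleRange]
    simp only [hv, Equiv.coe_mulLeft, Perm.mul_apply, Perm.decomposeFin_symm_apply_zero]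
    rw [Perm.decomposeFin.symm_sign, if_neg (Fin.succ_ne_zero j), Perm.sign_mul,
      Fin.sign_cycleRange]
    have h1 : ((-1 : ℝ) ^ (j : ℕ)) * (-1) ^ (j : ℕ) = 1 := by
      rw [← mul_pow]; simp
    push_cast
    rw [Fin.val_succ, pow_succ]
    linear_combination ((Perm.sign ρ : ℝ) * g (v j.succ)
      (fun i => j.succ.removeNth v (j.cycleRange (ρ i)))) * h1

theorem sum_perm_oneWedge (θ : E →ₗ[ℝ] ℝ) (a : E [⋀^Fin k]→ₗ[ℝ] ℝ) (v : Fin (k + 1) → E) :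
    ∑ π : Perm (Fin (k + 1)), (Perm.sign π : ℝ) * (θ (v (π 0)) * a (fun i => v (π i.succ))) =
      (k.factorial : ℝ) * oneWedge θ a v := by
  rw [sum_perm_succ (fun x w => θ x * a w) v, oneWedge_apply, Finset.mul_sum]
  refine Finset.sum_congr rfl fun p _ => ?_
  have h : ∀ ρ : Perm (Fin k), (Perm.sign ρ : ℝ) * (θ (v p) * a (fun i => p.removeNth v (ρ i))) =
      θ (v p) * a (p.removeNth v) := by
    intro ρ
    have h1 := a.map_perm (p.removeNth v) ρ
    rw [Function.comp_def] at h1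
    rw [h1]
    rcases Int.units_eq_one_or (Perm.sign ρ) with h | h <;> simp [h]
  rw [Finset.sum_congr rfl fun ρ _ => h ρ]
  simp [Fintype.card_perm]
  ring

theorem sum_perm_twoWedge (σ : E →ₗ[ℝ] E →ₗ[ℝ] ℝ) (a : E [⋀^Fin k]→ₗ[ℝ] ℝ)
    (v : Fin (k + 2) → E) :
    ∑ π : Perm (Fin (k + 2)), (Perm.sign π : ℝ) *
        (σ (v (π 0)) (v (π 1)) * a (fun i => v (π i.succ.succ))) =
      (k.factorial : ℝ) * (2 * twoWedge σ a v) := by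
  rw [twoWedge_apply]
  have := sum_perm_succ (fun x w => σ x (w 0) * a (fun i => w i.succ)) v
  simp only [Fin.succ_zero_eq_one] at this
  rw [this, ← mul_assoc 2, mul_one_div_cancel two_ne_zero, one_mul, Finset.mul_sum]
  refine Finset.sum_congr rfl fun p _ => ?_
  rw [sum_perm_oneWedge (σ (v p)) a (p.removeNth v)]
  ring

/-- Each shuffle class contains k! l! permutations with equal contributions; summing over all
permutations avoids choosing representatives. -/
theorem factorial_mul_wedge {l : ℕ} (a : E [⋀^Fin k]→ₗ[ℝ] ℝ) (b : E [⋀^Fin l]→ₗ[ℝ] ℝ)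
    (v : Fin (k + l) → E) :
    ((k.factorial * l.factorial : ℕ) : ℝ) * wedge a b v =
      ∑ π : Perm (Fin (k + l)), (Perm.sign π : ℝ) *
        (a (fun i => v (π (Fin.castAdd l i))) * b (fun j => v (π (Fin.natAdd k j)))) := by
  have h := congrArg (fun f => LinearMap.mul' ℝ ℝ (f (fun i => v (finSumFinEquiv i))))
    (MultilinearMap.domCoprod_alternization_eq a b)
  simp only [Fintype.card_fin, AlternatingMap.smul_apply, map_nsmul,
    MultilinearMap.alternatization_apply, map_sum] at h
  have hw : wedge a b v = LinearMap.mul' ℝ ℝ (a.domCoprod b fun i => v (finSumFinEquiv i)) := rfl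
  rw [hw, ← nsmul_eq_mul, ← h, ← (Equiv.permCongr finSumFinEquiv).sum_comp]
  refine Finset.sum_congr rfl fun π _ => ?_
  rw [Perm.sign_permCongr]
  rcases Int.units_eq_one_or (Perm.sign π) with h | h <;>
    simp [h, Equiv.permCongr_apply, MultilinearMap.domDomCongr_apply]

/-- A rotation moves the last slot to the front. Its sign (-1)^k is where evenness enters; for a
two-form the rotation is applied twice and has sign 1 in every degree. -/
theorem wedge_eq_oneWedge (hk : Even k) (a : E [⋀^Fin k]→ₗ[ℝ] ℝ) (b : E [⋀^Fin 1]→ₗ[ℝ] ℝ)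
    (θ : E →ₗ[ℝ] ℝ) (hθ : ∀ x, b ![x] = θ x) : wedge a b = oneWedge θ a := by
  ext v
  have h := factorial_mul_wedge a b v
  rw [← Equiv.sum_comp (Equiv.mulRight (finRotate (k + 1)))] at h
  have h2 := sum_perm_oneWedge θ a v
  rw [Finset.sum_congr rfl (g := fun π : Perm (Fin (k + 1)) =>
    (Perm.sign π : ℝ) * (θ (v (π 0)) * a (fun i => v (π i.succ))))] at h
  · rw [h2] at h
    simp only [Nat.factorial_one, mul_one] at h
    exact mul_left_cancel₀ (by positivity) h
  · intro π _
    have e1 : ∀ i : Fin k, finRotate (k + 1) (Fin.castAdd 1 i) = i.succ :=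
      fun i => finRotate_of_lt (k := i) (by omega)
    have e2 : ∀ j : Fin 1, finRotate (k + 1) (Fin.natAdd k j) = 0 := by
      intro j
      rw [show Fin.natAdd k j = Fin.last k by ext; simp]
      simp
    have hs : Perm.sign (finRotate (k + 1)) = 1 := by
      rw [sign_finRotate, Nat.add_sub_cancel, hk.neg_one_pow]
    simp only [Equiv.coe_mulRight, Perm.mul_apply, e1, e2, Perm.sign_mul, hs, mul_one]
    rw [← hθ, show (![v (π 0)] : Fin 1 → E) = fun _ => v (π 0) by ext i; simp]
    ring

theorem wedge_eq_twoWedge (a : E [⋀^Fin k]→ₗ[ℝ] ℝ) (b : E [⋀^Fin 2]→ₗ[ℝ] ℝ)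
    (σ : E →ₗ[ℝ] E →ₗ[ℝ] ℝ) (hσ : ∀ x y, b ![x, y] = σ x y) : wedge a b = twoWedge σ a := by
  ext v
  have h := factorial_mul_wedge a b v
  rw [← Equiv.sum_comp (Equiv.mulRight (finRotate (k + 2) * finRotate (k + 2)))] at h
  have h2 := sum_perm_twoWedge σ a v
  rw [Finset.sum_congr rfl (g := fun π : Perm (Fin (k + 2)) => (Perm.sign π : ℝ) *
        (σ (v (π 0)) (v (π 1)) * a (fun i => v (π i.succ.succ))))] at h
  · rw [h2, Nat.factorial_two] at h
    push_cast at h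
    rw [mul_assoc] at h
    exact mul_left_cancel₀ two_ne_zero (mul_left_cancel₀ (by positivity) h)
  · intro π _
    have e1 : ∀ i : Fin k, (finRotate (k + 2) * finRotate (k + 2)) (Fin.castAdd 2 i) =
        i.succ.succ := by
      intro i
      have : finRotate (k + 2) (Fin.castAdd 2 i) = i.castSucc.succ :=
        finRotate_of_lt (k := i) (by omega)
      rw [Perm.mul_apply, this]
      exact finRotate_of_lt (k := i + 1) (by omega)
    have e2 : (finRotate (k + 2) * finRotate (k + 2)) (Fin.natAdd k 0) = 0 := by
      have : finRotate (k + 2) (Fin.natAdd k 0) = Fin.last (k + 1) :=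
        finRotate_of_lt (k := k) (by omega)
      rw [Perm.mul_apply, this, finRotate_last]
    have e3 : (finRotate (k + 2) * finRotate (k + 2)) (Fin.natAdd k 1) = 1 := by
      have : (Fin.natAdd k 1 : Fin (k + 2)) = Fin.last (k + 1) := by ext; simp
      rw [Perm.mul_apply, this, finRotate_last]
      exact finRotate_of_lt (k := 0) (by omega)
    have e4 : (fun j => v (π ((finRotate (k + 2) * finRotate (k + 2)) (Fin.natAdd k j)))) =
        ![v (π 0), v (π 1)] := by
      ext j
      fin_cases j
      · exact congrArg (fun i => v (π i)) e2
      · exact congrArg (fun i => v (π i)) e3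
    simp only [Equiv.coe_mulRight, Perm.mul_apply π, e1, e4, hσ, Perm.sign_mul, Int.units_mul_self,
      mul_one]
    ring

theorem wedgePow_eq_twoPow (b : E [⋀^Fin 2]→ₗ[ℝ] ℝ) (σ : E →ₗ[ℝ] E →ₗ[ℝ] ℝ)
    (hσ : ∀ x y, b ![x, y] = σ x y) : ∀ n, wedgePow b n = twoPow σ n
  | 0 => rfl
  | n + 1 => by
    rw [wedgePow, wedgePow_eq_twoPow b σ hσ n]
    exact wedge_eq_twoWedge _ b σ hσ

end WedgeComparison

/-! ### Tangent spaces of regular level sets, by the inverse function theorem. -/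

section Tangent

variable {E : Type*} [NormedAddCommGroup E] [NormedSpace ℝ E]

theorem tangentSpace_subset_ker {c : ℕ} {M U : Set E} {F : E → Fin c → ℝ}
    {F' : E →L[ℝ] (Fin c → ℝ)} {x : E} (hU : IsOpen U) (hxU : x ∈ U)
    (hM : M ∩ U = {y | y ∈ U ∧ F y = 0}) (hF' : HasFDerivAt F F' x) :
    tangentSpace M x ⊆ {v | F' v = 0} := by
  rintro v ⟨γ, δ, hδ, -, hγM, hγ0, hγ'⟩
  have h1 : HasDerivAt (F ∘ γ) (F' v) 0 := by
    rw [← hγ0] at hF'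
    exact hF'.comp_hasDerivAt 0 hγ'
  have h2 : F ∘ γ =ᶠ[𝓝 0] fun _ => 0 := by
    have hU' : ∀ᶠ t in 𝓝 0, γ t ∈ U :=
      hγ'.continuousAt.eventually_mem (hU.mem_nhds (by rwa [hγ0]))
    filter_upwards [hU', Ioo_mem_nhds (neg_lt_zero.2 hδ) hδ] with t ht ht'
    exact (hM.le ⟨hγM t ht', ht⟩).2
  exact h1.unique ((hasDerivAt_const (0 : ℝ) (0 : Fin c → ℝ)).congr_of_eventuallyEq h2)

theorem ker_subset_tangentSpace [CompleteSpace E] {c : ℕ} {M U : Set E} {F : E → Fin c → ℝ}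
    {F' : E →L[ℝ] (Fin c → ℝ)} {x : E} (hU : IsOpen U) (hxU : x ∈ U) (hxM : x ∈ M)
    (hM : M ∩ U = {y | y ∈ U ∧ F y = 0}) (hF : ContDiff ℝ ω F) (hF' : HasFDerivAt F F' x)
    (hsurj : Function.Surjective F') :
    {v | F' v = 0} ⊆ tangentSpace M x := by
  intro v hv
  obtain ⟨A₀, hA₀⟩ := (F' : E →ₗ[ℝ] (Fin c → ℝ)).exists_rightInverse_of_surjective
    (LinearMap.range_eq_top.2 hsurj)
  set A : (Fin c → ℝ) →L[ℝ] E := A₀.toContinuousLinearMap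
  have hA : ∀ s, F' (A s) = s := fun s => congrArg (fun f => f s) hA₀
  set L : ℝ × (Fin c → ℝ) →L[ℝ] E :=
    (ContinuousLinearMap.fst ℝ ℝ _).smulRight v + A.comp (ContinuousLinearMap.snd ℝ ℝ _)
  have hL : ∀ p, L p = p.1 • v + A p.2 := fun p => rfl
  -- As A is a right inverse of F' and F' v = 0, the derivative of H at 0 is the identity. The local
  -- inverse along (s, 0) then yields a curve in the level set with velocity v.
  set H : ℝ × (Fin c → ℝ) → ℝ × (Fin c → ℝ) := fun p => (p.1, F (x + L p))
  have hH : ContDiffAt ℝ ω H 0 :=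
    (contDiff_fst.prodMk (hF.comp (contDiff_const.add L.contDiff))).contDiffAt
  have hH' : HasFDerivAt H
      ((ContinuousLinearEquiv.refl ℝ (ℝ × (Fin c → ℝ)) : _ →L[ℝ] _)) 0 := by
    have h1 : HasFDerivAt (fun p => x + L p) L 0 := L.hasFDerivAt.const_add x
    have h2 : HasFDerivAt F F' (x + L 0) := by simpa using hF'
    have h3 := (hasFDerivAt_fst (𝕜 := ℝ) (p := (0 : ℝ × (Fin c → ℝ)))).prodMk (h2.comp 0 h1)
    convert! h3 using 1
    refine ContinuousLinearMap.ext fun p => ?_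
    simp only [ContinuousLinearEquiv.coe_coe, ContinuousLinearEquiv.refl_apply,
      ContinuousLinearMap.prod_apply, ContinuousLinearMap.comp_apply, hL, map_add, map_smul, hA]
    rw [show F' v = 0 from hv]
    simp
  have hH0 : H 0 = 0 := by
    have : F x = 0 := (hM.le ⟨hxM, hxU⟩).2
    simp [H, this]
  have hω : (ω : WithTop ℕ∞) ≠ 0 := by simp
  have hst := hH.hasStrictFDerivAt' hH' hω
  set G := hst.localInverse H _ 0
  have hG : ContDiffAt ℝ ω G 0 := by
    have := hH.to_localInverse hH' hω
    rwa [hH0] at this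
  have hG0 : G 0 = 0 := by
    have := hst.localInverse_apply_image
    rwa [hH0] at this
  have hG' : HasFDerivAt G (ContinuousLinearMap.id ℝ (ℝ × (Fin c → ℝ))) 0 := by
    have := hst.to_localInverse.hasFDerivAt
    rw [hH0] at this
    exact this
  have hGr : ∀ᶠ y in 𝓝 0, H (G y) = y := by
    have := hst.eventually_right_inverse
    rwa [hH0] at this
  set ι : ℝ →L[ℝ] ℝ × (Fin c → ℝ) := ContinuousLinearMap.inl ℝ ℝ _
  have hι0 : ι 0 = 0 := map_zero _
  set γ : ℝ → E := fun t => x + L (G (ι t))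
  have hγ0 : γ 0 = x := by simp [γ, hι0, hG0]
  have hγs : ContDiffAt ℝ ω γ 0 := by
    have : ContDiffAt ℝ ω G (ι 0) := by rwa [hι0]
    exact contDiffAt_const.add (L.contDiff.contDiffAt.comp 0 (this.comp 0 ι.contDiff.contDiffAt))
  have hγ' : HasDerivAt γ v 0 := by
    have h1 : HasFDerivAt G (ContinuousLinearMap.id ℝ (ℝ × (Fin c → ℝ))) (ι 0) := by rwa [hι0]
    have h2 : HasDerivAt ι (ι 1) 0 := ι.hasDerivAt
    have h3 := (L.hasFDerivAt.comp_hasDerivAt 0 (h1.comp_hasDerivAt 0 h2)).const_add x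
    convert! h3 using 1
    simp [hL, ι]
  have hγM : ∀ᶠ t in 𝓝 0, γ t ∈ M := by
    have h1 : ∀ᶠ t in 𝓝 (0 : ℝ), H (G (ι t)) = ι t := by
      have : Tendsto ι (𝓝 0) (𝓝 0) := by
        have := ι.continuous.tendsto 0
        rwa [hι0] at this
      exact this.eventually hGr
    have h2 : ∀ᶠ t in 𝓝 (0 : ℝ), γ t ∈ U :=
      hγ'.continuousAt.eventually_mem (hU.mem_nhds (by rwa [hγ0]))
    filter_upwards [h1, h2] with t ht1 ht2
    exact (hM.ge ⟨ht2, congrArg Prod.snd ht1⟩).1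
  -- Analyticity at 0 holds on a whole neighbourhood, whereas for order ∞ the neighbourhood could
  -- shrink with the order of differentiation. Hence the hypothesis of class ω on F.
  have hev : ∀ᶠ t in 𝓝 (0 : ℝ), ContDiffAt ℝ ω γ t := hγs.eventually (by simp)
  obtain ⟨δ, hδ, hball⟩ := Metric.eventually_nhds_iff.1 (hγM.and hev)
  have hIoo : ∀ t ∈ Ioo (-δ) δ, dist t 0 < δ := fun t ht => by
    rw [Real.dist_0_eq_abs]; exact abs_lt.2 ht
  exact ⟨γ, δ, hδ, fun t ht => ((hball (hIoo t ht)).2.of_le le_top).contDiffWithinAt,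
    fun t ht => (hball (hIoo t ht)).1, hγ0, hγ'⟩

end Tangent

section Milnor

open scoped ComplexConjugate

variable {n : ℕ} {ε : ℝ} {t : ℂ}

/-! ### Complex conjugation and the quadratic form -/

/-- Coordinatewise complex conjugation. -/
def cj (n : ℕ) : Cn n →L[ℝ] Cn n :=
  LinearMap.toContinuousLinearMap
    { toFun := fun z => WithLp.toLp 2 fun j => conj (z j)
      map_add' := fun z w => by ext j; simp
      map_smul' := fun c z => by ext j; simp }

@[simp]
theorem cj_apply (z : Cn n) (j : Fin (n + 1)) : cj n z j = conj (z j) := rfl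

@[simp]
theorem cj_cj (z : Cn n) : cj n (cj n z) = z := by ext j; simp

theorem cj_smul (c : ℂ) (z : Cn n) : cj n (c • z) = conj c • cj n z := by ext j; simp

theorem inner_cj_cj (z w : Cn n) : inner ℂ (cj n z) (cj n w) = inner ℂ w z := by
  simp [PiLp.inner_apply, mul_comm]

theorem inner_cj_comm (z w : Cn n) : inner ℂ (cj n z) w = inner ℂ (cj n w) z := by
  simp [PiLp.inner_apply, mul_comm]

theorem norm_cj (z : Cn n) : ‖cj n z‖ = ‖z‖ := by
  simp [EuclideanSpace.norm_eq]

theorem P_eq_inner (z : Cn n) : P n z = inner ℂ (cj n z) z := by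
  simp [P, PiLp.inner_apply, sq]

theorem inner_cj_right_self (z : Cn n) : inner ℂ z (cj n z) = conj (P n z) := by
  rw [P_eq_inner, inner_conj_symm]

theorem P_smul (c : ℂ) (z : Cn n) : P n (c • z) = c ^ 2 * P n z := by
  simp [P, Finset.mul_sum, mul_pow]

/-- With `norm_add_smul_cj_sq`, this controls the vectors z + a z̄ from which the tubular
coordinates are built. -/
theorem P_add_smul_cj (a : ℂ) (z : Cn n) :
    P n (z + a • cj n z) = P n z + 2 * a * (‖z‖ : ℂ) ^ 2 + a ^ 2 * conj (P n z) := by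
  rw [P_eq_inner, map_add, cj_smul, cj_cj]
  simp only [inner_add_left, inner_add_right, inner_smul_left, inner_smul_right,
    inner_self_eq_norm_sq_to_K, Complex.conj_conj, inner_cj_right_self, P_eq_inner, norm_cj]
  simp only [Complex.coe_algebraMap]
  ring

theorem norm_sq_eq_inner (z : Cn n) : (‖z‖ : ℂ) ^ 2 = inner ℂ z z :=
  (inner_self_eq_norm_sq_to_K z).symm

theorem norm_add_smul_cj_sq (a : ℂ) (z : Cn n) :
    (‖z + a • cj n z‖ : ℂ) ^ 2 =
      (1 + (‖a‖ : ℂ) ^ 2) * (‖z‖ : ℂ) ^ 2 + a * conj (P n z) + conj a * P n z := by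
  rw [norm_sq_eq_inner, norm_sq_eq_inner]
  simp only [inner_add_left, inner_add_right, inner_smul_left, inner_smul_right, inner_cj_cj,
    inner_cj_right_self, P_eq_inner]
  rw [← Complex.conj_mul']
  ring

theorem real_inner_eq (u v : Cn n) : inner ℝ u v = (inner ℂ u v).re := by
  simp [PiLp.inner_apply]

theorem finrank_Cn (n : ℕ) : Module.finrank ℝ (Cn n) = 2 * (n + 1) := by
  rw [← Module.finrank_mul_finrank ℝ ℂ (Cn n)]; simp

/-! ### Derivatives -/

/-- The derivative of `z ↦ |z|²`. -/
def dNorm (z : Cn n) : Cn n →L[ℝ] ℝ := 2 • innerSL ℝ z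

/-- The derivative of `P`. -/
def dP (z : Cn n) : Cn n →L[ℝ] ℂ := 2 • (innerSL ℂ (cj n z)).restrictScalars ℝ

theorem dNorm_apply (z v : Cn n) : dNorm z v = 2 * (inner ℂ z v).re := by
  simp [dNorm, real_inner_eq]

theorem dP_apply (z v : Cn n) : dP z v = 2 * inner ℂ (cj n z) v := by
  simp [dP]

theorem hasFDerivAt_norm_sq_sub (ε : ℝ) (z : Cn n) :
    HasFDerivAt (fun y : Cn n => ‖y‖ ^ 2 - ε ^ 2) (dNorm z) z :=
  (hasStrictFDerivAt_norm_sq z).hasFDerivAt.sub_const _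

theorem hasFDerivAt_P (z : Cn n) : HasFDerivAt (P n) (dP z) z := by
  have h : HasFDerivAt (fun y => inner ℂ (cj n y) y) _ z :=
    (cj n).hasFDerivAt.inner ℂ (hasFDerivAt_id z)
  rw [show P n = fun y => inner ℂ (cj n y) y from funext P_eq_inner]
  convert! h using 1
  refine ContinuousLinearMap.ext fun v => ?_
  rw [dP_apply]
  simp [fderivInnerCLM_apply, inner_cj_comm v z]
  ring

theorem contDiff_P (n : ℕ) {m : WithTop ℕ∞} : ContDiff ℝ m (P n) := by
  rw [show P n = fun y => inner ℂ (cj n y) y from funext P_eq_inner]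
  exact (cj n).contDiff.inner ℂ contDiff_id

theorem continuous_P (n : ℕ) : Continuous (P n) := (contDiff_P n (m := 0)).continuous

/-- The real-linear function `w ↦ Re (conj t * w)`. -/
def reMul (t : ℂ) : ℂ →L[ℝ] ℝ := Complex.reCLM.comp (ContinuousLinearMap.mul ℝ ℂ (conj t))

/-- The real-linear function `w ↦ Im (conj t * w)`. -/
def imMul (t : ℂ) : ℂ →L[ℝ] ℝ := Complex.imCLM.comp (ContinuousLinearMap.mul ℝ ℂ (conj t))

theorem reMul_apply (t w : ℂ) : reMul t w = (conj t * w).re := rfl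

theorem imMul_apply (t w : ℂ) : imMul t w = (conj t * w).im := rfl

/-- The equation of the sphere. -/
def sphereEq (n : ℕ) (ε : ℝ) (z : Cn n) : Fin 1 → ℝ := ![‖z‖ ^ 2 - ε ^ 2]

/-- The equations of the binding. -/
def bindingEq (n : ℕ) (ε : ℝ) (z : Cn n) : Fin 3 → ℝ :=
  ![‖z‖ ^ 2 - ε ^ 2, (P n z).re, (P n z).im]

/-- The equations of a page. -/
def pageEq (n : ℕ) (ε : ℝ) (t : ℂ) (z : Cn n) : Fin 2 → ℝ :=
  ![‖z‖ ^ 2 - ε ^ 2, imMul t (P n z)]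

theorem contDiff_norm_sq_sub (n : ℕ) (ε : ℝ) {m : WithTop ℕ∞} :
    ContDiff ℝ m (fun y : Cn n => ‖y‖ ^ 2 - ε ^ 2) :=
  (contDiff_norm_sq ℝ).sub contDiff_const

theorem contDiff_sphereEq (n : ℕ) (ε : ℝ) : ContDiff ℝ ω (sphereEq n ε) := by
  refine contDiff_pi.2 fun i => ?_
  fin_cases i
  exact contDiff_norm_sq_sub n ε

theorem contDiff_bindingEq (n : ℕ) (ε : ℝ) : ContDiff ℝ ω (bindingEq n ε) := by
  refine contDiff_pi.2 fun i => ?_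
  fin_cases i
  · exact contDiff_norm_sq_sub n ε
  · exact Complex.reCLM.contDiff.comp (contDiff_P n)
  · exact Complex.imCLM.contDiff.comp (contDiff_P n)

theorem contDiff_pageEq (n : ℕ) (ε : ℝ) (t : ℂ) : ContDiff ℝ ω (pageEq n ε t) := by
  refine contDiff_pi.2 fun i => ?_
  fin_cases i
  · exact contDiff_norm_sq_sub n ε
  · exact (imMul t).contDiff.comp (contDiff_P n)

theorem hasFDerivAt_sphereEq (z : Cn n) :
    HasFDerivAt (sphereEq n ε) (ContinuousLinearMap.pi ![dNorm z]) z := by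
  refine hasFDerivAt_pi.2 fun i => ?_
  fin_cases i
  exact hasFDerivAt_norm_sq_sub ε z

theorem hasFDerivAt_bindingEq (z : Cn n) :
    HasFDerivAt (bindingEq n ε) (ContinuousLinearMap.pi
      ![dNorm z, Complex.reCLM.comp (dP z), Complex.imCLM.comp (dP z)]) z := by
  refine hasFDerivAt_pi.2 fun i => ?_
  fin_cases i
  · exact hasFDerivAt_norm_sq_sub ε z
  · exact Complex.reCLM.hasFDerivAt.comp z (hasFDerivAt_P z)
  · exact Complex.imCLM.hasFDerivAt.comp z (hasFDerivAt_P z)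

theorem hasFDerivAt_pageEq (z : Cn n) :
    HasFDerivAt (pageEq n ε t) (ContinuousLinearMap.pi ![dNorm z, (imMul t).comp (dP z)]) z := by
  refine hasFDerivAt_pi.2 fun i => ?_
  fin_cases i
  · exact hasFDerivAt_norm_sq_sub ε z
  · exact (imMul t).hasFDerivAt.comp z (hasFDerivAt_P z)

/-! ### The sphere, the binding and the pages as level sets -/

theorem norm_sq_sub_eq_zero_iff (hε : 0 < ε) (z : Cn n) :
    ‖z‖ ^ 2 - ε ^ 2 = 0 ↔ z ∈ Metric.sphere (0 : Cn n) ε := by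
  rw [sub_eq_zero, mem_sphere_zero_iff_norm, sq_eq_sq₀ (norm_nonneg z) hε.le]

theorem inner_self_of_mem {z : Cn n} (hz : z ∈ Metric.sphere (0 : Cn n) ε) :
    inner ℂ z z = (ε : ℂ) ^ 2 := by
  rw [← norm_sq_eq_inner, mem_sphere_zero_iff_norm.1 hz]

theorem sphere_inter (hε : 0 < ε) :
    Metric.sphere (0 : Cn n) ε ∩ univ = {y | y ∈ univ ∧ sphereEq n ε y = 0} := by
  ext y
  simpa [sphereEq, funext_iff] using (norm_sq_sub_eq_zero_iff hε y).symm

theorem K_inter (hε : 0 < ε) : K n ε ∩ univ = {y | y ∈ univ ∧ bindingEq n ε y = 0} := by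
  ext y
  simp only [bindingEq, funext_iff, Fin.forall_fin_succ, K, mem_inter_iff, mem_ofPred_eq,
    ← norm_sq_sub_eq_zero_iff hε, mem_univ, true_and, and_true, Complex.ext_iff]
  simp

/-- As |t| = 1, the phase of P is t exactly when t̄P is real and positive. This trades Θ for an
analytic equation on an open set. -/
theorem mem_page_iff (ht : t ∈ Metric.sphere (0 : ℂ) 1) {z : Cn n} :
    z ∈ page (Metric.sphere (0 : Cn n) ε) (K n ε) (Θ n) t ↔
      z ∈ Metric.sphere (0 : Cn n) ε ∧ 0 < reMul t (P n z) ∧ imMul t (P n z) = 0 := by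
  have ht1 : ‖t‖ = 1 := mem_sphere_zero_iff_norm.1 ht
  have htt : conj t * t = 1 := by rw [Complex.conj_mul', ht1]; simp
  constructor
  · rintro ⟨⟨hz, hK⟩, hΘ⟩
    have hP : P n z ≠ 0 := fun h => hK ⟨hz, h⟩
    have hq : conj t * P n z = (‖P n z‖ : ℂ) := by
      have hP' : (‖P n z‖ : ℂ) ≠ 0 := by simpa using hP
      rw [← hΘ] at htt ⊢
      calc conj (Θ n z) * P n z = conj (Θ n z) * Θ n z * ‖P n z‖ := by
            simp only [Θ]; field_simp
        _ = _ := by rw [htt, one_mul]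
    refine ⟨hz, ?_, ?_⟩
    · rw [reMul_apply, hq]; simpa using hP
    · rw [imMul_apply, hq]; simp
  · rintro ⟨hz, hre, him⟩
    rw [reMul_apply] at hre
    rw [imMul_apply] at him
    have hP : P n z ≠ 0 := fun h => by simp [h] at hre
    refine ⟨⟨hz, fun h => hP h.2⟩, ?_⟩
    set q := (conj t * P n z).re
    have hq : conj t * P n z = q := Complex.ext (by simp [q]) (by simpa using him)
    have hPq : P n z = q * t := by
      rw [← hq]; linear_combination -(P n z) * htt
    have hn : ‖P n z‖ = q := by rw [hPq]; simp [ht1, abs_of_pos hre]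
    have hq0 : (q : ℂ) ≠ 0 := by exact_mod_cast hre.ne'
    rw [Θ, hn, hPq]; field_simp

theorem page_inter (hε : 0 < ε) (ht : t ∈ Metric.sphere (0 : ℂ) 1) :
    page (Metric.sphere (0 : Cn n) ε) (K n ε) (Θ n) t ∩ {y | 0 < reMul t (P n y)} =
      {y | y ∈ {y | 0 < reMul t (P n y)} ∧ pageEq n ε t y = 0} := by
  ext y
  simp only [mem_inter_iff, mem_page_iff ht, pageEq, mem_ofPred_eq, funext_iff,
    Fin.forall_fin_succ, ← norm_sq_sub_eq_zero_iff hε]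
  simp
  tauto

theorem isOpen_page_domain (n : ℕ) (t : ℂ) : IsOpen {y : Cn n | 0 < reMul t (P n y)} :=
  isOpen_lt continuous_const ((reMul t).continuous.comp (continuous_P n))

theorem surjective_sphereEq (hε : 0 < ε) {z : Cn n} (hz : z ∈ Metric.sphere (0 : Cn n) ε) :
    Function.Surjective (ContinuousLinearMap.pi ![dNorm z] : Cn n →L[ℝ] Fin 1 → ℝ) := by
  intro y
  refine ⟨((y 0 / (2 * ε ^ 2) : ℝ) : ℂ) • z, ?_⟩
  have hε' := hε.ne'
  ext i
  fin_cases i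
  simp only [ContinuousLinearMap.coe_pi', Fin.zero_eta, Matrix.cons_val_fin_one, dNorm_apply,
    inner_smul_right, inner_self_of_mem hz, ← Complex.ofReal_pow, ← Complex.ofReal_mul,
    Complex.ofReal_re]
  field_simp

theorem surjective_bindingEq (hε : 0 < ε) {z : Cn n} (hz : z ∈ K n ε) :
    Function.Surjective (ContinuousLinearMap.pi
      ![dNorm z, Complex.reCLM.comp (dP z), Complex.imCLM.comp (dP z)] :
        Cn n →L[ℝ] Fin 3 → ℝ) := by
  intro y
  have hε' : (ε : ℂ) ≠ 0 := by exact_mod_cast hε.ne'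
  -- On K, ⟨z, z̄⟩ = conj P = 0: the direction z moves only the norm, and z̄ only P.
  set v : Cn n := ((y 0 / (2 * ε ^ 2) : ℝ) : ℂ) • z +
    ((y 1 + y 2 * Complex.I) / (2 * ε ^ 2) : ℂ) • cj n z
  have h0 : inner ℂ z v = ((y 0 / 2 : ℝ) : ℂ) := by
    simp only [v, inner_add_right, inner_smul_right, inner_self_of_mem hz.1, inner_cj_right_self,
      hz.2]
    push_cast
    simp only [map_zero, mul_zero, add_zero]
    field_simp
  have h1 : inner ℂ (cj n z) v = (y 1 + y 2 * Complex.I) / 2 := by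
    simp only [v, inner_add_right, inner_smul_right, inner_cj_cj, inner_self_of_mem hz.1,
      ← P_eq_inner, hz.2]
    field_simp
    ring
  refine ⟨v, ?_⟩
  have h2 : 2 * ((y 1 + y 2 * Complex.I) / 2) = (y 1 + y 2 * Complex.I) := by ring
  ext i
  fin_cases i
  · simp [dNorm_apply, h0]
    ring
  · simp [dP_apply, h1, h2]
  · simp [dP_apply, h1, h2]

theorem conj_mul_self_eq_one (ht : t ∈ Metric.sphere (0 : ℂ) 1) : conj t * t = 1 := by
  rw [Complex.conj_mul', mem_sphere_zero_iff_norm.1 ht]; simp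

theorem P_eq_of_mem_page (ht : t ∈ Metric.sphere (0 : ℂ) 1) {z : Cn n}
    (him : imMul t (P n z) = 0) : P n z = (reMul t (P n z) : ℂ) * t := by
  have hq : conj t * P n z = (reMul t (P n z) : ℂ) :=
    Complex.ext (by simp [reMul_apply]) (by rw [Complex.ofReal_im]; exact him)
  rw [← hq]
  linear_combination -(P n z) * conj_mul_self_eq_one ht

theorem surjective_pageEq (hε : 0 < ε) (ht : t ∈ Metric.sphere (0 : ℂ) 1) {z : Cn n}
    (hz : z ∈ page (Metric.sphere (0 : Cn n) ε) (K n ε) (Θ n) t) :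
    Function.Surjective (ContinuousLinearMap.pi ![dNorm z, (imMul t).comp (dP z)] :
        Cn n →L[ℝ] Fin 2 → ℝ) := by
  intro y
  obtain ⟨hzS, -, him⟩ := (mem_page_iff ht).1 hz
  have hε' : (ε : ℂ) ≠ 0 := by exact_mod_cast hε.ne'
  have htt := conj_mul_self_eq_one ht
  have hP := P_eq_of_mem_page ht him
  set q := reMul t (P n z)
  -- The vectors z and z̄ need not be orthogonal here, but the cross terms are harmless: ⟨z, itz̄⟩ =
  -- iq is imaginary and t̄⟨z̄, z⟩ = q is real.
  set v : Cn n := ((y 0 / (2 * ε ^ 2) : ℝ) : ℂ) • z +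
    (((y 1 / (2 * ε ^ 2) : ℝ) : ℂ) * (Complex.I * t)) • cj n z
  have h0 : inner ℂ z v = ((y 0 / 2 : ℝ) : ℂ) +
      ((y 1 / (2 * ε ^ 2) * q : ℝ) : ℂ) * Complex.I := by
    simp only [v, inner_add_right, inner_smul_right, inner_self_of_mem hzS, inner_cj_right_self,
      hP, map_mul, Complex.conj_ofReal]
    push_cast
    field_simp
    linear_combination (y 1 * q * Complex.I) * htt
  have h1 : conj t * (2 * inner ℂ (cj n z) v) =
      ((y 0 / ε ^ 2 * q : ℝ) : ℂ) + (y 1 : ℂ) * Complex.I := by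
    simp only [v, inner_add_right, inner_smul_right, inner_cj_cj, inner_self_of_mem hzS,
      ← P_eq_inner, hP]
    push_cast
    field_simp
    linear_combination (y 0 * q + y 1 * ε ^ 2 * Complex.I) * htt
  refine ⟨v, ?_⟩
  ext i
  fin_cases i
  · simp only [Fin.zero_eta, ContinuousLinearMap.coe_pi', Matrix.cons_val_zero, dNorm_apply, h0,
      Complex.add_re, Complex.ofReal_re, Complex.re_ofReal_mul, Complex.I_re]
    ring
  · simp only [Fin.mk_one, ContinuousLinearMap.coe_pi', Matrix.cons_val_one,
      Matrix.cons_val_fin_one, ContinuousLinearMap.comp_apply, dP_apply, imMul_apply, h1,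
      Complex.add_im, Complex.ofReal_im, Complex.im_ofReal_mul, Complex.I_im]
    ring

/-! ### Submanifolds and tangent spaces -/

theorem isSubmanifold_sphere (hε : 0 < ε) :
    IsSubmanifold (2 * n + 1) (Metric.sphere (0 : Cn n) ε) := by
  refine ⟨1, by rw [finrank_Cn]; ring, fun z hz => ⟨univ, sphereEq n ε, isOpen_univ, mem_univ z,
    ((contDiff_sphereEq n ε).of_le le_top).contDiffOn, ?_, sphere_inter hε⟩⟩
  rw [(hasFDerivAt_sphereEq z).fderiv]
  exact surjective_sphereEq hε hz

theorem isSubmanifold_K (hε : 0 < ε) : IsSubmanifold (2 * n + 1) (K (n + 1) ε) := by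
  refine ⟨3, by rw [finrank_Cn]; ring, fun z hz => ⟨univ, bindingEq (n + 1) ε, isOpen_univ,
    mem_univ z, ((contDiff_bindingEq (n + 1) ε).of_le le_top).contDiffOn, ?_, K_inter hε⟩⟩
  rw [(hasFDerivAt_bindingEq z).fderiv]
  exact surjective_bindingEq hε hz

theorem isSubmanifold_page (hε : 0 < ε) (ht : t ∈ Metric.sphere (0 : ℂ) 1) :
    IsSubmanifold (2 * n) (page (Metric.sphere (0 : Cn n) ε) (K n ε) (Θ n) t) := by
  refine ⟨2, by rw [finrank_Cn]; ring, fun z hz => ⟨_, pageEq n ε t, isOpen_page_domain n t,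
    ((mem_page_iff ht).1 hz).2.1, ((contDiff_pageEq n ε t).of_le le_top).contDiffOn, ?_,
    page_inter hε ht⟩⟩
  rw [(hasFDerivAt_pageEq z).fderiv]
  exact surjective_pageEq hε ht hz

theorem mem_tangentSpace_sphere (hε : 0 < ε) {z : Cn n} (hz : z ∈ Metric.sphere (0 : Cn n) ε)
    (v : Cn n) : v ∈ tangentSpace (Metric.sphere (0 : Cn n) ε) z ↔ (inner ℂ z v).re = 0 := by
  have h := Subset.antisymm
    (tangentSpace_subset_ker isOpen_univ (mem_univ z) (sphere_inter hε) (hasFDerivAt_sphereEq z))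
    (ker_subset_tangentSpace isOpen_univ (mem_univ z) hz (sphere_inter hε)
      (contDiff_sphereEq n ε) (hasFDerivAt_sphereEq z) (surjective_sphereEq hε hz))
  rw [h]
  simp [funext_iff, dNorm_apply]

theorem mem_tangentSpace_K (hε : 0 < ε) {z : Cn n} (hz : z ∈ K n ε) (v : Cn n) :
    v ∈ tangentSpace (K n ε) z ↔ (inner ℂ z v).re = 0 ∧ inner ℂ (cj n z) v = 0 := by
  have h := Subset.antisymm
    (tangentSpace_subset_ker isOpen_univ (mem_univ z) (K_inter hε) (hasFDerivAt_bindingEq z))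
    (ker_subset_tangentSpace isOpen_univ (mem_univ z) hz (K_inter hε)
      (contDiff_bindingEq n ε) (hasFDerivAt_bindingEq z) (surjective_bindingEq hε hz))
  rw [h]
  simp [funext_iff, Fin.forall_fin_succ, dNorm_apply, dP_apply, Complex.ext_iff (z := inner ℂ _ _)]

theorem mem_tangentSpace_page (hε : 0 < ε) (ht : t ∈ Metric.sphere (0 : ℂ) 1) {z : Cn n}
    (hz : z ∈ page (Metric.sphere (0 : Cn n) ε) (K n ε) (Θ n) t) (v : Cn n) :
    v ∈ tangentSpace (page (Metric.sphere (0 : Cn n) ε) (K n ε) (Θ n) t) z ↔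
      (inner ℂ z v).re = 0 ∧ imMul t (inner ℂ (cj n z) v) = 0 := by
  have hzU := ((mem_page_iff ht).1 hz).2.1
  have h := Subset.antisymm
    (tangentSpace_subset_ker (isOpen_page_domain n t) hzU (page_inter hε ht)
      (hasFDerivAt_pageEq z))
    (ker_subset_tangentSpace (isOpen_page_domain n t) hzU hz (page_inter hε ht)
      (contDiff_pageEq n ε t) (hasFDerivAt_pageEq z) (surjective_pageEq hε ht hz))
  rw [h]
  have h2 : imMul t (2 * inner ℂ (cj n z) v) = 2 * imMul t (inner ℂ (cj n z) v) := by
    rw [imMul_apply, imMul_apply, mul_left_comm, ← Complex.ofReal_ofNat, Complex.im_ofReal_mul]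
  simp [funext_iff, Fin.forall_fin_succ, dNorm_apply, dP_apply, h2]

end Milnor

section Forms

open scoped ComplexConjugate

variable {n : ℕ} {ε : ℝ} {t : ℂ}

/-! ### The standard symplectic form and the powers of `dα₀` -/

/-- The standard symplectic form `∑ⱼ dxⱼ ∧ dyⱼ`, as a bilinear map. -/
def sympl (n : ℕ) : Cn n →ₗ[ℝ] Cn n →ₗ[ℝ] ℝ :=
  LinearMap.mk₂ ℝ (fun u v => (inner ℂ u v).im)
    (fun u v w => by simp) (fun c u v => by simp [inner_smul_left_eq_smul])
    (fun u v w => by simp) (fun c u v => by simp [inner_smul_right_eq_smul])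

theorem sympl_apply (u v : Cn n) : sympl n u v = (inner ℂ u v).im := rfl

theorem sympl_antisymm (u v : Cn n) : sympl n u v = -sympl n v u := by
  rw [sympl_apply, sympl_apply, ← inner_conj_symm, Complex.conj_im]

theorem α₀_apply_eq (z v : Cn n) : α₀ n z ![v] = ((1 / 2 : ℝ) • sympl n z) v := by
  rw [α₀_apply]
  simp only [LinearMap.smul_apply, smul_eq_mul, sympl_apply, PiLp.inner_apply, Complex.im_sum]
  congr 1
  refine Finset.sum_congr rfl fun j _ => ?_
  simp
  ring

/-- `α₀` as a linear function of the base point. -/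
def α₀CLM (n : ℕ) : Cn n →L[ℝ] Cn n [⋀^Fin 1]→L[ℝ] ℝ :=
  have hv : ∀ v : Fin 1 → Cn n, v = ![v 0] := fun v => by ext i; fin_cases i; rfl
  LinearMap.toContinuousLinearMap
    { toFun := α₀ n
      map_add' := fun x y => by
        ext v
        rw [hv v, ContinuousAlternatingMap.add_apply]
        simp only [α₀_apply_eq]
        simp
      map_smul' := fun c x => by
        ext v
        rw [hv v, ContinuousAlternatingMap.smul_apply]
        simp only [α₀_apply_eq]
        simp
        ring }

theorem coe_α₀CLM (n : ℕ) : ⇑(α₀CLM n) = α₀ n := rfl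

theorem contDiff_α₀ (n : ℕ) {m : WithTop ℕ∞} : ContDiff ℝ m (α₀ n) := (α₀CLM n).contDiff

theorem extDeriv_α₀ (n : ℕ) : extDeriv (α₀ n) = fun _ =>
    ContinuousAlternatingMap.alternatizeUncurryFin (α₀CLM n) := by
  funext x
  rw [extDeriv, ← coe_α₀CLM, (α₀CLM n).fderiv]

theorem extDeriv_α₀_apply (x u v : Cn n) : extDeriv (α₀ n) x ![u, v] = sympl n u v := by
  have h1 : (Fin.removeNth 0 ![u, v] : Fin 1 → Cn n) = ![v] := by
    ext i; fin_cases i; rfl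
  have h2 : (Fin.removeNth 1 ![u, v] : Fin 1 → Cn n) = ![u] := by
    ext i; fin_cases i; rfl
  rw [extDeriv_α₀, ContinuousAlternatingMap.alternatizeUncurryFin_apply, Fin.sum_univ_two, h1, h2,
    coe_α₀CLM, α₀_apply_eq, α₀_apply_eq]
  simp
  rw [sympl_antisymm v u]
  ring

theorem dPow_α₀ (k : ℕ) (x : Cn n) : dPow (α₀ n) k x = twoPow (sympl n) k :=
  wedgePow_eq_twoPow _ _ (fun u v => extDeriv_α₀_apply x u v) k

theorem contactVolume_α₀ (k : ℕ) (x : Cn n) :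
    contactVolume (α₀ n) k x = oneWedge ((1 / 2 : ℝ) • sympl n x) (twoPow (sympl n) k) := by
  rw [contactVolume, dPow_α₀]
  exact wedge_eq_oneWedge (even_two_mul k) _ _ _ fun v => α₀_apply_eq x v

/-! ### Evaluation on frames -/

theorem sympl_I_smul (z v : Cn n) : sympl n (Complex.I • z) v = -(inner ℂ z v).re := by
  simp [sympl_apply]

theorem sympl_I_smul_right (z : Cn n) : sympl n z (Complex.I • z) = ‖z‖ ^ 2 := by
  rw [sympl_apply, inner_smul_right, ← norm_sq_eq_inner, ← Complex.ofReal_pow, Complex.I_mul_im,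
    Complex.ofReal_re]

/-- The vector iz has the Reeb direction: σ(iz, ·) = -Re⟨z, ·⟩ vanishes on vectors tangent to the
sphere, so only the term α₀(iz) survives. -/
theorem contactVolume_cons_I_smul (k : ℕ) (z : Cn n) {v : Fin (2 * k) → Cn n}
    (h : ∀ i, (inner ℂ z (v i)).re = 0) :
    contactVolume (α₀ n) k z (Fin.cons (Complex.I • z) v : Fin (2 * k + 1) → Cn n) =
      1 / 2 * ‖z‖ ^ 2 * twoPow (sympl n) k v := by
  rw [contactVolume_α₀, oneWedge_twoPow_cons sympl_antisymm _ _ _ fun i => by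
    rw [sympl_I_smul, h i, neg_zero]]
  rw [LinearMap.smul_apply, sympl_I_smul_right, smul_eq_mul]

/-- Split off e and ie, with σ(e, ie) = |e|² > 0, and continue in the Hermitian complement of e in
V, which is σ-orthogonal to e. -/
theorem exists_twoPow_pos (m : ℕ) : ∀ V : Submodule ℂ (Cn n), m ≤ Module.finrank ℂ V →
    ∃ v : Fin (2 * m) → Cn n, (∀ i, v i ∈ V) ∧ 0 < twoPow (sympl n) m v := by
  induction m with
  | zero => exact fun V _ => ⟨fun _ => 0, fun _ => V.zero_mem, by simp [twoPow]⟩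
  | succ m ih =>
    intro V hV
    have hV' : V ≠ ⊥ := by
      rintro rfl
      simp at hV
    obtain ⟨e, heV, he⟩ := V.exists_mem_ne_zero_of_ne_bot hV'
    have hle : (Submodule.span ℂ {e}) ≤ V := by simpa using heV
    have hfr := Submodule.finrank_add_inf_finrank_orthogonal hle
    rw [finrank_span_singleton he] at hfr
    obtain ⟨v, hv, hpos⟩ := ih ((Submodule.span ℂ {e})ᗮ ⊓ V) (by omega)
    refine ⟨(Fin.cons e (Fin.cons (Complex.I • e) v : Fin (2 * m + 1) → Cn n) :
      Fin (2 * m + 1 + 1) → Cn n), ?_, ?_⟩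
    · intro i
      refine Fin.cases heV (fun i => ?_) (i : Fin (2 * m + 1 + 1))
      refine Fin.cases (V.smul_mem _ heV) (fun i => (hv i).2) i
    · rw [twoPow_cons_cons sympl_antisymm m e _ fun i => by
        rw [sympl_apply, Submodule.mem_orthogonal_singleton_iff_inner_right.1 (hv i).1,
          Complex.zero_im], sympl_I_smul_right]
      have : 0 < ‖e‖ := norm_pos_iff.2 he
      positivity

theorem re_inner_I_smul_self (z : Cn n) : (inner ℂ z (Complex.I • z)).re = 0 := by
  rw [inner_smul_right, ← norm_sq_eq_inner, ← Complex.ofReal_pow, Complex.I_mul_re,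
    Complex.ofReal_im, neg_zero]

theorem isContactForm_sphere (hε : 0 < ε) :
    IsContactForm n (Metric.sphere (0 : Cn n) ε) (α₀ n) where
  submanifold := isSubmanifold_sphere hε
  smooth := contDiff_α₀ n
  nonvanishing z hz := by
    have hz0 : z ≠ 0 := by
      rintro rfl
      simp at hz
      exact hε.ne hz
    have hfr := (Submodule.span ℂ {z}).finrank_add_finrank_orthogonal
    rw [finrank_span_singleton hz0, finrank_euclideanSpace_fin] at hfr
    obtain ⟨v, hv, hpos⟩ := exists_twoPow_pos n (Submodule.span ℂ {z})ᗮ (by omega)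
    have hv' : ∀ i, inner ℂ z (v i) = 0 := fun i =>
      Submodule.mem_orthogonal_singleton_iff_inner_right.1 (hv i)
    refine ⟨Fin.cons (Complex.I • z) v, fun i => ?_, ?_⟩
    · rw [mem_tangentSpace_sphere hε hz]
      refine Fin.cases (re_inner_I_smul_self z) (fun i => ?_) i
      rw [Fin.cons_succ, hv', Complex.zero_re]
    · rw [contactVolume_cons_I_smul n z fun i => by rw [hv', Complex.zero_re]]
      have : 0 < ‖z‖ := norm_pos_iff.2 hz0
      positivity

theorem isContactForm_K (hε : 0 < ε) : IsContactForm n (K (n + 1) ε) (α₀ (n + 1)) where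
  submanifold := isSubmanifold_K hε
  smooth := contDiff_α₀ _
  nonvanishing z hz := by
    have hz0 : z ≠ 0 := by
      rintro rfl
      have := hz.1
      simp at this
      exact hε.ne this
    -- Vectors orthogonal to z and z̄ are tangent to K, and so is iz, since dP(iz) = 2iP = 0.
    set V : Submodule ℂ (Cn (n + 1)) := Submodule.span ℂ ({z, cj _ z} : Finset (Cn (n + 1)))
    have hfr := V.finrank_add_finrank_orthogonal
    have hV : Module.finrank ℂ V ≤ 2 :=
      (finrank_span_finset_le_card _).trans Finset.card_le_two
    rw [finrank_euclideanSpace_fin] at hfr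
    obtain ⟨v, hv, hpos⟩ := exists_twoPow_pos n Vᗮ (by omega)
    have hv1 : ∀ i, inner ℂ z (v i) = 0 := fun i =>
      (Submodule.mem_orthogonal _ _).1 (hv i) _ (Submodule.subset_span (by simp))
    have hv2 : ∀ i, inner ℂ (cj _ z) (v i) = 0 := fun i =>
      (Submodule.mem_orthogonal _ _).1 (hv i) _ (Submodule.subset_span (by simp))
    refine ⟨Fin.cons (Complex.I • z) v, fun i => ?_, ?_⟩
    · rw [mem_tangentSpace_K hε hz]
      refine Fin.cases ⟨re_inner_I_smul_self z, ?_⟩ (fun i => ?_) i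
      · rw [Fin.cons_zero, inner_smul_right, ← P_eq_inner, hz.2, mul_zero]
      · rw [Fin.cons_succ, hv1, hv2]
        exact ⟨Complex.zero_re, rfl⟩
    · rw [contactVolume_cons_I_smul n z fun i => by rw [hv1, Complex.zero_re]]
      have : 0 < ‖z‖ := norm_pos_iff.2 hz0
      positivity

/-! ### The pages are symplectic -/

theorem inner_I_smul_cj_of_mem_page (ht : t ∈ Metric.sphere (0 : ℂ) 1) {z : Cn n}
    (him : imMul t (P n z) = 0) :
    inner ℂ z ((Complex.I * t) • cj n z) = Complex.I * (reMul t (P n z) : ℂ) := by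
  have hP := P_eq_of_mem_page ht him
  rw [inner_smul_right, inner_cj_right_self]
  conv_lhs => rw [hP]
  rw [map_mul, Complex.conj_ofReal]
  linear_combination (Complex.I * (reMul t (P n z) : ℂ)) * conj_mul_self_eq_one ht

theorem imMul_inner_I_smul (t : ℂ) (z : Cn n) :
    imMul t (inner ℂ (cj n z) (Complex.I • z)) = reMul t (P n z) := by
  rw [inner_smul_right, ← P_eq_inner, imMul_apply, reMul_apply, mul_left_comm]
  simp

/-- Split v = h₀ + s·iz with h₀ orthogonal to z. Testing against ih₀, corrected to be tangent to the
page, gives |h₀|² = 0; then tangency of s·iz forces sq = 0 with q > 0. -/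
theorem eq_zero_of_sympl_eq_zero (hε : 0 < ε) (ht : t ∈ Metric.sphere (0 : ℂ) 1) {z v : Cn n}
    (hz : z ∈ page (Metric.sphere (0 : Cn n) ε) (K n ε) (Θ n) t)
    (hv1 : (inner ℂ z v).re = 0) (hv2 : imMul t (inner ℂ (cj n z) v) = 0)
    (h : ∀ w, (inner ℂ z w).re = 0 → imMul t (inner ℂ (cj n z) w) = 0 → sympl n v w = 0) :
    v = 0 := by
  obtain ⟨hzS, hq, him⟩ := (mem_page_iff ht).1 hz
  set q := reMul t (P n z)
  set s : ℝ := (inner ℂ z v).im / ε ^ 2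
  have hzz := inner_self_of_mem hzS
  have hε' : (ε : ℂ) ≠ 0 := by exact_mod_cast hε.ne'
  have hzv : inner ℂ z v = (s * ε ^ 2 : ℝ) * Complex.I := by
    have : s * ε ^ 2 = (inner ℂ z v).im := by
      simp only [s]; field_simp
    rw [this]
    exact Complex.ext (by simp [hv1]) (by simp)
  have hvz : inner ℂ v z = -((s * ε ^ 2 : ℝ) * Complex.I) := by
    rw [← inner_conj_symm, hzv]; simp
  set h₀ : Cn n := v - ((s : ℂ) * Complex.I) • z
  have hh₀ : inner ℂ z h₀ = 0 := by
    simp only [h₀, inner_sub_right, inner_smul_right, hzz, hzv]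
    push_cast
    ring
  -- The multiple of iz that makes ih₀ tangent to the page. Subtracting it does not change the
  -- pairing with v, as σ(v, iz) = Re⟨v, z⟩ = 0.
  set d : ℝ := imMul t (inner ℂ (cj n z) (Complex.I • h₀)) / q
  have hw := h (Complex.I • h₀ - (d : ℂ) • (Complex.I • z)) ?_ ?_
  · have hs1 : sympl n v (Complex.I • z) = 0 := by
      rw [sympl_apply, inner_smul_right, hvz, Complex.I_mul_im, Complex.neg_re,
        Complex.re_ofReal_mul, Complex.I_re, mul_zero, neg_zero]
    have hs2 : sympl n v (Complex.I • h₀) = ‖h₀‖ ^ 2 := by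
      have : v = h₀ + ((s : ℂ) * Complex.I) • z := by simp [h₀]
      rw [sympl_apply]
      conv_lhs => rw [this]
      rw [inner_add_left, inner_smul_left, inner_smul_right z, hh₀, inner_smul_right,
        ← norm_sq_eq_inner, ← Complex.ofReal_pow, mul_zero, mul_zero, add_zero,
        Complex.I_mul_im, Complex.ofReal_re]
    rw [map_sub, Complex.coe_smul, (sympl n v).map_smul d, hs1, hs2] at hw
    have hh : h₀ = 0 := by simpa using hw
    have hvs : v = (s : ℂ) • (Complex.I • z) := by
      rw [smul_smul]; exact sub_eq_zero.1 hh
    have hs : s * q = 0 := by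
      rw [hvs, inner_smul_right, imMul_apply, mul_left_comm, Complex.im_ofReal_mul,
        ← imMul_apply, imMul_inner_I_smul] at hv2
      exact hv2
    have hs0 : s = 0 := by
      rcases mul_eq_zero.1 hs with h | h
      · exact h
      · exact absurd h hq.ne'
    rw [hvs, hs0]
    simp
  · rw [inner_sub_right, inner_smul_right z h₀, hh₀, inner_smul_right, Complex.sub_re,
      Complex.re_ofReal_mul, re_inner_I_smul_self]
    simp
  · rw [inner_sub_right, map_sub, inner_smul_right _ (Complex.I • z), imMul_apply t (_ * _),
      mul_left_comm, Complex.im_ofReal_mul, ← imMul_apply, imMul_inner_I_smul]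
    simp only [d]
    have := hq.ne'
    field_simp
    ring

theorem isSymplecticForm_page (hε : 0 < ε) (ht : t ∈ Metric.sphere (0 : ℂ) 1) :
    IsSymplecticForm n (page (Metric.sphere (0 : Cn n) ε) (K n ε) (Θ n) t)
      (extDeriv (α₀ n)) where
  submanifold := isSubmanifold_page hε ht
  smooth := by rw [extDeriv_α₀]; exact contDiff_const
  closed z _ v _ := by
    rw [extDeriv_α₀, extDeriv]
    simp [ContinuousAlternatingMap.alternatizeUncurryFin_apply]
  nondegenerate z hz v hv hv0 := by
    rw [mem_tangentSpace_page hε ht hz] at hv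
    by_contra! hcon
    refine hv0 (eq_zero_of_sympl_eq_zero hε ht hz hv.1 hv.2 fun w hw1 hw2 => ?_)
    rw [← extDeriv_α₀_apply z]
    exact hcon w ((mem_tangentSpace_page hε ht hz w).2 ⟨hw1, hw2⟩)

end Forms

section Orientation

open scoped ComplexConjugate

variable {n : ℕ} {ε : ℝ} {t : ℂ}

/-! ### The orientation of the binding -/

theorem continuous_oneWedge_of {X : Type*} [TopologicalSpace X] {k : ℕ}
    {a : Cn n [⋀^Fin k]→ₗ[ℝ] ℝ} (ha : Continuous fun v => a v) {u : X → Cn n}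
    {v : X → Fin (k + 1) → Cn n} (c : ℝ) (hu : Continuous u) (hv : Continuous v) :
    Continuous fun x => oneWedge (c • sympl n (u x)) a (v x) := by
  simp only [oneWedge_apply, LinearMap.smul_apply, sympl_apply, smul_eq_mul]
  refine continuous_finsetSum _ fun i _ => continuous_const.mul (Continuous.mul ?_ ?_)
  · exact continuous_const.mul
      (Complex.continuous_im.comp (hu.inner ((continuous_apply i).comp hv)))
  · exact ha.comp (continuous_pi fun j => (continuous_apply (i.succAbove j)).comp hv)

theorem continuous_twoPow (n : ℕ) : ∀ m : ℕ, Continuous fun v => twoPow (sympl n) m v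
  | 0 => continuous_of_const fun _ _ => rfl
  | m + 1 => by
    have h : ∀ v : Fin (2 * m + 1 + 1) → Cn n, twoPow (sympl n) (m + 1) v = _ :=
      fun v => twoWedge_apply (sympl n) (twoPow (sympl n) m) v
    refine (continuous_congr h).2 (continuous_const.mul (continuous_finsetSum _ fun i _ =>
      continuous_const.mul ?_))
    have := continuous_oneWedge_of (continuous_twoPow n m) 1 (continuous_apply i)
      (v := fun v : Fin (2 * m + 1 + 1) → Cn n => i.removeNth v)
      (continuous_pi fun j => continuous_apply (i.succAbove j))
    simpa only [one_smul] using this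

/-- An outward pointing vector at a point `b` of the binding decreases `P / t`. -/
theorem exists_pos_of_isOutward (hε : 0 < ε) (ht : t ∈ Metric.sphere (0 : ℂ) 1) {b ν : Cn n}
    (hb : b ∈ K n ε)
    (h : IsOutward (page (Metric.sphere (0 : Cn n) ε) (K n ε) (Θ n) t) (K n ε) b ν) :
    (inner ℂ b ν).re = 0 ∧ ∃ r : ℝ, 0 < r ∧ inner ℂ (cj n b) ν = -(r * t) := by
  obtain ⟨hν, γ, δ, hδ, -, hγ, hγ0, hγ'⟩ := h
  -- Only a closed set containing the closure of the page is needed: its equations and inequality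
  -- can be differentiated along γ.
  set C : Set (Cn n) := {z | ‖z‖ ^ 2 - ε ^ 2 = 0 ∧ 0 ≤ reMul t (P n z) ∧ imMul t (P n z) = 0}
  have hC : IsClosed C := by
    have h1 : IsClosed {z : Cn n | ‖z‖ ^ 2 - ε ^ 2 = 0} :=
      isClosed_eq (contDiff_norm_sq_sub n ε (m := 0)).continuous continuous_const
    have h2 : IsClosed {z : Cn n | 0 ≤ reMul t (P n z)} :=
      isClosed_le continuous_const ((reMul t).continuous.comp (continuous_P n))
    have h3 : IsClosed {z : Cn n | imMul t (P n z) = 0} :=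
      isClosed_eq ((imMul t).continuous.comp (continuous_P n)) continuous_const
    exact h1.inter (h2.inter h3)
  have hsub : closure (page (Metric.sphere (0 : Cn n) ε) (K n ε) (Θ n) t) ⊆ C := by
    refine closure_minimal (fun z hz => ?_) hC
    obtain ⟨h1, h2, h3⟩ := (mem_page_iff ht).1 hz
    exact ⟨(norm_sq_sub_eq_zero_iff hε z).2 h1, h2.le, h3⟩
  have hγC : ∀ s ∈ Icc (-δ) 0, γ s ∈ C := fun s hs => hsub (hγ s hs)
  have hd : HasDerivWithinAt γ ν (Icc (-δ) 0) 0 := hγ'.mono Icc_subset_Iic_self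
  have h0 : (0 : ℝ) ∈ Icc (-δ) 0 := ⟨neg_nonpos.2 hδ.le, le_rfl⟩
  have huniq : UniqueDiffWithinAt ℝ (Icc (-δ) 0) 0 := uniqueDiffOn_Icc (neg_lt_zero.2 hδ) 0 h0
  have key : ∀ (f : Cn n → ℝ) (f' : Cn n →L[ℝ] ℝ), HasFDerivAt f f' b →
      HasDerivWithinAt (f ∘ γ) (f' ν) (Icc (-δ) 0) 0 := by
    intro f f' hf
    rw [← hγ0] at hf
    exact hf.comp_hasDerivWithinAt 0 hd
  have key0 : ∀ (f : Cn n → ℝ) (f' : Cn n →L[ℝ] ℝ), HasFDerivAt f f' b →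
      (∀ z ∈ C, f z = 0) → f' ν = 0 := by
    intro f f' hf hfC
    exact huniq.eq_deriv _ (key f f' hf) ((hasDerivWithinAt_const (0 : ℝ) _ (0 : ℝ)).congr
      (fun s hs => hfC _ (hγC s hs)) (hfC _ (hγC 0 h0)))
  have e1 := key0 _ _ (hasFDerivAt_norm_sq_sub ε b) fun z hz => hz.1
  have e2 := key0 _ _ ((imMul t).hasFDerivAt.comp b (hasFDerivAt_P b)) fun z hz => hz.2.2
  have e3 : reMul t (dP b ν) ≤ 0 := by
    have hr := key _ _ ((reMul t).hasFDerivAt.comp b (hasFDerivAt_P b))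
    have hmin : IsLocalMinOn ((reMul t ∘ P n) ∘ γ) (Icc (-δ) 0) 0 := by
      refine Filter.eventually_of_mem self_mem_nhdsWithin fun s hs => ?_
      simp only [Function.comp_apply, hγ0, hb.2, map_zero]
      exact (hγC s hs).2.1
    -- Re(t̄P) along γ is minimal at the right end point 0, so its derivative in the inward
    -- direction -δ is nonnegative.
    have hcone : (-δ : ℝ) ∈ posTangentConeAt (Icc (-δ) 0) 0 := by
      refine mem_posTangentConeAt_of_segment_subset ?_
      rw [zero_add, segment_symm, segment_eq_Icc (neg_nonpos.2 hδ.le)]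
    have := hmin.hasFDerivWithinAt_nonneg hr.hasFDerivWithinAt hcone
    simp only [ContinuousLinearMap.toSpanSingleton_apply, smul_eq_mul,
      ContinuousLinearMap.comp_apply] at this
    nlinarith
  have hre : (inner ℂ b ν).re = 0 := by
    rw [dNorm_apply] at e1
    linarith
  refine ⟨hre, -(reMul t (dP b ν)) / 2, ?_, ?_⟩
  -- If the derivative of Re(t̄P) vanished too, ν would be tangent to K.
  · by_contra hcon
    have hz : reMul t (dP b ν) = 0 := by linarith
    refine hν ((mem_tangentSpace_K hε hb ν).2 ⟨hre, ?_⟩)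
    have h1 : conj t * dP b ν = 0 := Complex.ext hz e2
    have h2 : dP b ν = 0 := by
      linear_combination t * h1 - (dP b ν) * conj_mul_self_eq_one ht
    simpa [dP_apply] using h2
  · have h1 : conj t * dP b ν = (reMul t (dP b ν) : ℂ) :=
      Complex.ext (by simp [reMul_apply]) (by rw [Complex.ofReal_im]; exact e2)
    have h2 : dP b ν = 2 * inner ℂ (cj n b) ν := dP_apply b ν
    push_cast
    rw [← h1]
    linear_combination (-(dP b ν) / 2) * conj_mul_self_eq_one ht - h2 / 2

theorem finrank_ker_pageEq (hε : 0 < ε) (ht : t ∈ Metric.sphere (0 : ℂ) 1) {z : Cn n}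
    (hz : z ∈ page (Metric.sphere (0 : Cn n) ε) (K n ε) (Θ n) t) :
    Module.finrank ℝ (LinearMap.ker (ContinuousLinearMap.pi ![dNorm z, (imMul t).comp (dP z)] :
        Cn n →L[ℝ] Fin 2 → ℝ).toLinearMap) = 2 * n := by
  have h := LinearMap.finrank_range_add_finrank_ker
    (ContinuousLinearMap.pi ![dNorm z, (imMul t).comp (dP z)] : Cn n →L[ℝ] Fin 2 → ℝ).toLinearMap
  rw [LinearMap.range_eq_top.2 (surjective_pageEq hε ht hz), finrank_top, finrank_Cn] at h
  rw [Module.finrank_fin_fun] at h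
  omega

theorem mem_ker_pageEq (z v : Cn n) :
    v ∈ LinearMap.ker (ContinuousLinearMap.pi ![dNorm z, (imMul t).comp (dP z)] :
        Cn n →L[ℝ] Fin 2 → ℝ).toLinearMap ↔
      (inner ℂ z v).re = 0 ∧ imMul t (inner ℂ (cj n z) v) = 0 := by
  have h2 : imMul t (2 * inner ℂ (cj n z) v) = 2 * imMul t (inner ℂ (cj n z) v) := by
    rw [imMul_apply, imMul_apply, mul_left_comm, ← Complex.ofReal_ofNat, Complex.im_ofReal_mul]
  simp [funext_iff, Fin.forall_fin_succ, dNorm_apply, dP_apply, h2]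

theorem apply_eq_zero_of_finrank_lt {E : Type*} [AddCommGroup E] [Module ℝ E] {m : ℕ}
    (a : E [⋀^Fin m]→ₗ[ℝ] ℝ) (W : Submodule ℝ E) [FiniteDimensional ℝ W] {v : Fin m → E}
    (hv : ∀ i, v i ∈ W) (hW : Module.finrank ℝ W < m) : a v = 0 := by
  refine a.map_linearDependent v fun hli => ?_
  have h : LinearIndependent ℝ fun i => (⟨v i, hv i⟩ : W) :=
    LinearIndependent.of_comp W.subtype hli
  have := h.fintype_card_le_finrank
  rw [Fintype.card_fin] at this
  omega

/-- On a page, `(dα₀)^n` is a positive multiple of the contact volume with the vector `i t z̄`,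
which is transverse to the page also along the binding, inserted. -/
theorem dPow_eq_contactVolume_cons (hε : 0 < ε) (ht : t ∈ Metric.sphere (0 : ℂ) 1) {z : Cn n}
    (hz : z ∈ page (Metric.sphere (0 : Cn n) ε) (K n ε) (Θ n) t) {v : Fin (2 * n) → Cn n}
    (hv : ∀ i, v i ∈ tangentSpace (page (Metric.sphere (0 : Cn n) ε) (K n ε) (Θ n) t) z) :
    1 / 2 * ε ^ 2 * dPow (α₀ n) n z v = reMul t (P n z) / ε ^ 2 *
      contactVolume (α₀ n) n z
        (Fin.cons ((Complex.I * t) • cj n z) v : Fin (2 * n + 1) → Cn n) := by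
  obtain ⟨hzS, -, him⟩ := (mem_page_iff ht).1 hz
  set q := reMul t (P n z)
  set W := LinearMap.ker (ContinuousLinearMap.pi ![dNorm z, (imMul t).comp (dP z)] :
        Cn n →L[ℝ] Fin 2 → ℝ).toLinearMap
  have hvW : ∀ i, v i ∈ W := fun i =>
    (mem_ker_pageEq z (v i)).2 ((mem_tangentSpace_page hε ht hz (v i)).1 (hv i))
  have hε' := hε.ne'
  -- The projection of iz to the page along itz̄; the coefficient is fixed by Im(t̄⟨z̄, iz⟩) = q and
  -- Im(t̄⟨z̄, itz̄⟩) = ε².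
  set u : Cn n := Complex.I • z - (q / ε ^ 2) • ((Complex.I * t) • cj n z)
  have hu : u ∈ W := by
    refine (mem_ker_pageEq z u).2 ⟨?_, ?_⟩
    · simp only [u]
      rw [← Complex.coe_smul, inner_sub_right, inner_smul_right z (_ • _),
        inner_I_smul_cj_of_mem_page ht him, Complex.sub_re, re_inner_I_smul_self,
        Complex.re_ofReal_mul, Complex.I_mul_re, Complex.ofReal_im]
      simp
    · simp only [u]
      rw [← Complex.coe_smul, inner_sub_right, inner_smul_right _ (_ • _), map_sub,
        imMul_inner_I_smul, imMul_apply, mul_left_comm, Complex.im_ofReal_mul, inner_smul_right,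
        inner_cj_cj, inner_self_of_mem hzS]
      have : conj t * (Complex.I * t * (ε : ℂ) ^ 2) = ((ε ^ 2 : ℝ) : ℂ) * Complex.I := by
        push_cast
        linear_combination (Complex.I * (ε : ℂ) ^ 2) * conj_mul_self_eq_one ht
      rw [this, Complex.im_ofReal_mul, Complex.I_im]
      field_simp
      simp [q]
  -- These are 2n + 1 vectors in a space of dimension 2n. So inserting iz amounts to inserting
  -- (q/ε²)·itz̄.
  have h0 : contactVolume (α₀ n) n z (Fin.cons u v : Fin (2 * n + 1) → Cn n) = 0 :=
    apply_eq_zero_of_finrank_lt _ W (Fin.cases hu hvW)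
      (by rw [finrank_ker_pageEq hε ht hz]; omega)
  have h1 := contactVolume_cons_I_smul n z fun i => ((mem_ker_pageEq z (v i)).1 (hvW i)).1
  rw [mem_sphere_zero_iff_norm.1 hzS, apply_cons] at h1
  rw [apply_cons] at h0 ⊢
  rw [dPow_α₀, ← h1]
  simp only [u, map_sub, map_smul, AlternatingMap.sub_apply, AlternatingMap.smul_apply,
    smul_eq_mul] at h0
  linarith

theorem boundaryOrientationAgrees_page (hε : 0 < ε) (ht : t ∈ Metric.sphere (0 : ℂ) 1) :
    BoundaryOrientationAgrees n
      (page (Metric.sphere (0 : Cn (n + 1)) ε) (K (n + 1) ε) (Θ (n + 1)) t)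
      (K (n + 1) ε) (α₀ (n + 1)) := by
  intro b hb ν hν v hv hpos
  obtain ⟨-, r, hr, hbν⟩ := exists_pos_of_isOutward hε ht hb hν
  set Y : Cn (n + 1) → Cn (n + 1) := fun z => (Complex.I * t) • cj (n + 1) z
  have hY : Continuous Y := (continuous_const_smul (Complex.I * t)).comp (cj (n + 1)).continuous
  set g : Cn (n + 1) × (Fin (2 * n + 1 + 1) → Cn (n + 1)) → ℝ := fun p =>
    contactVolume (α₀ (n + 1)) (n + 1) p.1
      (Fin.cons (Y p.1) p.2 : Fin (2 * n + 1 + 1 + 1) → Cn (n + 1))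
  have hg : Continuous g := by
    have h := continuous_oneWedge_of (continuous_twoPow (n + 1) (n + 1)) (1 / 2)
      (u := fun p : Cn (n + 1) × (Fin (2 * n + 1 + 1) → Cn (n + 1)) => p.1)
      (v := fun p => (Fin.cons (Y p.1) p.2 : Fin (2 * n + 1 + 1 + 1) → Cn (n + 1)))
      continuous_fst (continuous_pi fun i => by
        refine Fin.cases ?_ (fun i => ?_) i
        · exact hY.comp continuous_fst
        · exact (continuous_apply i).comp continuous_snd)
    refine (continuous_congr fun p => ?_).2 h
    simp only [g, contactVolume_α₀]
  -- At b both α₀(Y) and all σ(Y, vᵢ) vanish, because P(b) = 0 and vᵢ is tangent to K; σ(Y, ν) = r >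
  -- 0 remains.
  have hgb : 0 < g (b, (Fin.cons ν v : Fin (2 * n + 1 + 1) → Cn (n + 1))) := by
    have hσν : sympl (n + 1) (Y b) ν = r := by
      rw [sympl_apply, inner_smul_left, hbν]
      have : conj (Complex.I * t) * -(r * t) = (r : ℂ) * Complex.I := by
        rw [map_mul, Complex.conj_I]
        linear_combination ((r : ℂ) * Complex.I) * conj_mul_self_eq_one ht
      rw [this, Complex.im_ofReal_mul, Complex.I_im, mul_one]
    have h := oneWedge_twoPow_cons_cons sympl_antisymm ((1 / 2 : ℝ) • sympl (n + 1) b) n (Y b) ν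
      (v := v) ?_ ?_
    · rw [← contactVolume_α₀, hσν] at h
      have hg' : g (b, (Fin.cons ν v : Fin (2 * n + 1 + 1) → Cn (n + 1))) =
          (n + 1) * r * contactVolume (α₀ (n + 1)) n b v := by
        rw [contactVolume_α₀ n, ← h]
      rw [hg']
      positivity
    · rw [LinearMap.smul_apply, sympl_apply, inner_smul_right, inner_cj_right_self, hb.2]
      simp
    · intro i
      rw [sympl_apply, inner_smul_left, ((mem_tangentSpace_K hε hb (v i)).1 (hv i)).2]
      simp
  have hev := (hg.tendsto _).eventually (lt_mem_nhds hgb)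
  refine eventually_nhdsWithin_iff.2 (hev.mono fun p hp hpX => ?_)
  obtain ⟨hp1, hp2⟩ := hpX
  have hkey := dPow_eq_contactVolume_cons hε ht hp1 hp2
  have hq := ((mem_page_iff ht).1 hp1).2.1
  have hrhs : 0 < reMul t (P (n + 1) p.1) / ε ^ 2 * g p := by positivity
  rw [show g p = _ from rfl] at hrhs
  have : 0 < 1 / 2 * ε ^ 2 * dPow (α₀ (n + 1)) (n + 1) p.1 p.2 := by
    rw [hkey]; exact hrhs
  exact pos_of_mul_pos_right this (by positivity)

end Orientation

section OpenBook

open scoped ComplexConjugate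

variable {n : ℕ} {ε : ℝ} {t : ℂ}

/-! ### The fibration -/

theorem contDiffAt_Θ {z : Cn n} (hz : P n z ≠ 0) {m : WithTop ℕ∞} : ContDiffAt ℝ m (Θ n) z := by
  have hP : ContDiffAt ℝ m (P n) z := (contDiff_P n).contDiffAt
  have h : ContDiffAt ℝ m (fun z => (‖P n z‖ : ℂ)) z :=
    Complex.ofRealCLM.contDiff.contDiffAt.comp z (hP.norm ℝ hz)
  rw [show Θ n = fun z => P n z * (‖P n z‖ : ℂ)⁻¹ from funext fun _ => div_eq_mul_inv _ _]
  exact hP.mul (h.inv (by simpa using hz))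

theorem P_ne_zero_of_mem {z : Cn n} (hz : z ∈ Metric.sphere (0 : Cn n) ε \ K n ε) : P n z ≠ 0 :=
  fun h => hz.2 ⟨hz.1, h⟩

theorem norm_Θ {z : Cn n} (hz : P n z ≠ 0) : ‖Θ n z‖ = 1 := by
  simp [Θ, hz]

theorem Θ_smul {c : ℂ} (hc : ‖c‖ = 1) (z : Cn n) : Θ n (c • z) = c ^ 2 * Θ n z := by
  simp only [Θ, P_smul, norm_mul, norm_pow, hc, one_pow, one_mul, mul_div_assoc]

theorem smul_mem_sphere_diff {c : ℂ} (hc : ‖c‖ = 1) {z : Cn n}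
    (hz : z ∈ Metric.sphere (0 : Cn n) ε \ K n ε) :
    c • z ∈ Metric.sphere (0 : Cn n) ε \ K n ε := by
  have hc0 : c ≠ 0 := fun h => by simp [h] at hc
  refine ⟨?_, fun h => ?_⟩
  · rw [mem_sphere_zero_iff_norm, norm_smul, hc, one_mul]
    exact mem_sphere_zero_iff_norm.1 hz.1
  · have := h.2
    rw [P_smul] at this
    exact mul_ne_zero (pow_ne_zero 2 hc0) (P_ne_zero_of_mem hz) this

/-- The principal branch of the square root on the slit plane. -/
def root (w : ℂ) : ℂ := Complex.exp (Complex.log w / 2)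

theorem root_sq {w : ℂ} (hw : w ≠ 0) : root w ^ 2 = w := by
  rw [root, ← Complex.exp_nat_mul]
  push_cast
  rw [mul_div_cancel₀ _ two_ne_zero, Complex.exp_log hw]

theorem norm_root {w : ℂ} (hw : ‖w‖ = 1) : ‖root w‖ = 1 := by
  have hw0 : w ≠ 0 := fun h => by simp [h] at hw
  have h : ‖root w‖ ^ 2 = 1 := by rw [← norm_pow, root_sq hw0, hw]
  exact (pow_eq_one_iff_of_nonneg (norm_nonneg _) two_ne_zero).1 h

theorem root_ne_zero (w : ℂ) : root w ≠ 0 := Complex.exp_ne_zero _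

theorem contDiffAt_root {w : ℂ} (hw : w ∈ Complex.slitPlane) {m : WithTop ℕ∞} :
    ContDiffAt ℝ m root w :=
  (((Complex.contDiffAt_log hw).div_const 2).cexp).restrict_scalars ℝ

theorem Θ_surjOn (hε : 0 < ε) :
    SurjOn (Θ n) (Metric.sphere (0 : Cn n) ε \ K n ε) (Metric.sphere (0 : ℂ) 1) := by
  intro t ht
  have ht1 := mem_sphere_zero_iff_norm.1 ht
  have ht0 : t ≠ 0 := fun h => by simp [h] at ht1
  set z₀ : Cn n := EuclideanSpace.single 0 (ε : ℂ)
  have hP : P n z₀ = (ε : ℂ) ^ 2 := by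
    simp [P, z₀, ite_pow]
  have hε' : (ε : ℂ) ≠ 0 := by exact_mod_cast hε.ne'
  have hz₀ : z₀ ∈ Metric.sphere (0 : Cn n) ε \ K n ε := by
    refine ⟨?_, fun h => ?_⟩
    · simp [z₀, abs_of_pos hε]
    · have := h.2
      rw [hP] at this
      exact pow_ne_zero 2 hε' this
  have hΘ : Θ n z₀ = 1 := by
    simp [Θ, hP, hε']
  refine ⟨root t • z₀, smul_mem_sphere_diff (norm_root ht1) hz₀, ?_⟩
  rw [Θ_smul (norm_root ht1), root_sq ht0, hΘ, mul_one]

/-- A scalar c with c² = t/t₀ carries the page over t₀ to the page over t; the principal root is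
smooth where t̄₀t lies in the slit plane. -/
theorem Θ_locallyTrivial (t₀ : ℂ) (ht₀ : t₀ ∈ Metric.sphere (0 : ℂ) 1) :
    ∃ (U : Set ℂ) (Φ : ℂ × Cn n → Cn n), IsOpen U ∧ t₀ ∈ U ∧
      IsDiffeoOn Φ ((U ∩ Metric.sphere (0 : ℂ) 1) ×ˢ
          page (Metric.sphere (0 : Cn n) ε) (K n ε) (Θ n) t₀)
        ((Metric.sphere (0 : Cn n) ε \ K n ε) ∩ Θ n ⁻¹' U) ∧
      ∀ t ∈ U ∩ Metric.sphere (0 : ℂ) 1,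
        ∀ x ∈ page (Metric.sphere (0 : Cn n) ε) (K n ε) (Θ n) t₀, Θ n (Φ (t, x)) = t := by
  have h1 := conj_mul_self_eq_one ht₀
  have hn₀ := mem_sphere_zero_iff_norm.1 ht₀
  have hunit : ∀ t : ℂ, ‖t‖ = 1 → ‖conj t₀ * t‖ = 1 := fun t ht => by
    rw [norm_mul, RCLike.norm_conj, hn₀, ht, one_mul]
  have hsq : ∀ t : ℂ, ‖t‖ = 1 → root (conj t₀ * t) ^ 2 = conj t₀ * t := fun t ht =>
    root_sq fun h => by simpa [h] using hunit t ht
  have hmul : Continuous fun t : ℂ => conj t₀ * t := continuous_const.mul continuous_id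
  have hmul' : ContDiff ℝ ∞ fun t : ℂ => conj t₀ * t := contDiff_const.mul contDiff_id
  have hfib : ∀ t ∈ {t : ℂ | conj t₀ * t ∈ Complex.slitPlane} ∩ Metric.sphere (0 : ℂ) 1,
      ∀ x ∈ page (Metric.sphere (0 : Cn n) ε) (K n ε) (Θ n) t₀,
        Θ n (root (conj t₀ * t) • x) = t := by
    intro t ht x hx
    have ht1 := mem_sphere_zero_iff_norm.1 ht.2
    rw [Θ_smul (norm_root (hunit t ht1)), hsq t ht1, hx.2]
    linear_combination t * h1
  refine ⟨{t | conj t₀ * t ∈ Complex.slitPlane}, fun p => root (conj t₀ * p.1) • p.2,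
    Complex.isOpen_slitPlane.preimage hmul, ?_, ⟨?_, ?_, ?_⟩, hfib⟩
  · change conj t₀ * t₀ ∈ Complex.slitPlane
    rw [h1]
    exact Complex.one_mem_slitPlane
  · rintro ⟨t, x⟩ ⟨⟨htU, -⟩, -⟩
    have h2 : ContDiffAt ℝ ∞ (fun p : ℂ × Cn n => conj t₀ * p.1) (t, x) :=
      (hmul'.comp contDiff_fst).contDiffAt
    have h3 : ContDiffAt ℝ ∞ (fun p : ℂ × Cn n => root (conj t₀ * p.1)) (t, x) :=
      ContDiffAt.comp (g := root) (t, x) (contDiffAt_root htU) h2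
    exact (h3.smul contDiffAt_snd).contDiffWithinAt
  · rintro ⟨t, x⟩ ⟨ht, hx⟩
    refine ⟨smul_mem_sphere_diff (norm_root (hunit t (mem_sphere_zero_iff_norm.1 ht.2))) hx.1, ?_⟩
    rw [mem_preimage, hfib t ht x hx]
    exact ht.1
  · refine ⟨fun z => (Θ n z, (root (conj t₀ * Θ n z))⁻¹ • z), ?_, ?_, ?_, ?_⟩
    · rintro z ⟨hz, hzU⟩
      have hΘ : ContDiffAt ℝ ∞ (Θ n) z := contDiffAt_Θ (P_ne_zero_of_mem hz)
      have h2 : ContDiffAt ℝ ∞ (fun z => conj t₀ * Θ n z) z := hmul'.contDiffAt.comp z hΘ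
      have h3 : ContDiffAt ℝ ∞ (fun z => root (conj t₀ * Θ n z)) z :=
        ContDiffAt.comp (g := root) z (contDiffAt_root hzU) h2
      exact (hΘ.prodMk ((h3.inv (root_ne_zero _)).smul contDiffAt_id)).contDiffWithinAt
    · rintro z ⟨hz, hzU⟩
      have hn := norm_Θ (P_ne_zero_of_mem hz)
      have hr : ‖(root (conj t₀ * Θ n z))⁻¹‖ = 1 := by
        rw [norm_inv, norm_root (hunit _ hn), inv_one]
      refine ⟨⟨hzU, mem_sphere_zero_iff_norm.2 hn⟩, smul_mem_sphere_diff hr hz, ?_⟩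
      have hΘ0 : Θ n z ≠ 0 := fun h => by simp [h] at hn
      rw [Θ_smul hr, inv_pow, hsq _ hn, mul_inv, mul_assoc, inv_mul_cancel₀ hΘ0, mul_one]
      exact inv_eq_of_mul_eq_one_right h1
    · rintro ⟨t, x⟩ ⟨ht, hx⟩
      simp only [hfib t ht x hx, smul_smul, inv_mul_cancel₀ (root_ne_zero _), one_smul]
    · rintro z -
      simp only [smul_smul, mul_inv_cancel₀ (root_ne_zero _), one_smul]

/-! ### The tubular neighbourhood of the binding -/

/-- The inverse of `w ↦ 2 w / (1 + |w|²)` on the open unit disk. -/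
def diskInv (p : ℂ) : ℂ := ((1 + √(1 - ‖p‖ ^ 2))⁻¹ : ℝ) • p

/-- The Pythagorean identity behind stereographic projection; it makes the square root in `diskInv`
rational in |w|². -/
theorem norm_sq_two_div_smul (w : ℂ) :
    1 - ‖(2 / (1 + ‖w‖ ^ 2) : ℝ) • w‖ ^ 2 = ((1 - ‖w‖ ^ 2) / (1 + ‖w‖ ^ 2)) ^ 2 := by
  rw [norm_smul, mul_pow, Real.norm_eq_abs, sq_abs]
  have : 1 + ‖w‖ ^ 2 ≠ 0 := by positivity
  field_simp
  ring

theorem diskInv_two_div_smul {w : ℂ} (hw : ‖w‖ < 1) :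
    diskInv ((2 / (1 + ‖w‖ ^ 2) : ℝ) • w) = w := by
  have h1 : 0 ≤ 1 - ‖w‖ ^ 2 := by nlinarith [norm_nonneg w]
  rw [diskInv, norm_sq_two_div_smul, Real.sqrt_sq (by positivity), smul_smul]
  have h2 : (1 + (1 - ‖w‖ ^ 2) / (1 + ‖w‖ ^ 2))⁻¹ * (2 / (1 + ‖w‖ ^ 2)) = 1 := by
    have : 1 + ‖w‖ ^ 2 ≠ 0 := by positivity
    have h3 : 1 + (1 - ‖w‖ ^ 2) / (1 + ‖w‖ ^ 2) = 2 / (1 + ‖w‖ ^ 2) := by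
      field_simp; ring
    rw [h3, inv_mul_cancel₀ (by positivity)]
  rw [h2, one_smul]

theorem norm_two_div_smul_lt {w : ℂ} (hw : ‖w‖ < 1) : ‖(2 / (1 + ‖w‖ ^ 2) : ℝ) • w‖ < 1 := by
  have h := norm_sq_two_div_smul w
  have h1 : 0 < 1 - ‖w‖ ^ 2 := by nlinarith [norm_nonneg w]
  have h2 : 0 < ((1 - ‖w‖ ^ 2) / (1 + ‖w‖ ^ 2)) ^ 2 := by positivity
  nlinarith [norm_nonneg ((2 / (1 + ‖w‖ ^ 2) : ℝ) • w)]

theorem norm_diskInv_sq {p : ℂ} (hp : ‖p‖ < 1) :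
    ‖diskInv p‖ ^ 2 = (1 - √(1 - ‖p‖ ^ 2)) / (1 + √(1 - ‖p‖ ^ 2)) := by
  have h1 : 0 ≤ 1 - ‖p‖ ^ 2 := by nlinarith [norm_nonneg p]
  have hs := Real.sqrt_nonneg (1 - ‖p‖ ^ 2)
  have hs2 := Real.sq_sqrt h1
  rw [diskInv, norm_smul, mul_pow, Real.norm_eq_abs, sq_abs]
  set s := √(1 - ‖p‖ ^ 2)
  have : 1 + s ≠ 0 := by positivity
  field_simp
  linarith

theorem norm_diskInv_lt {p : ℂ} (hp : ‖p‖ < 1) : ‖diskInv p‖ < 1 := by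
  have h1 : 0 < 1 - ‖p‖ ^ 2 := by nlinarith [norm_nonneg p]
  have hs := Real.sqrt_pos.2 h1
  have h : ‖diskInv p‖ ^ 2 < 1 := by
    rw [norm_diskInv_sq hp, div_lt_one (by positivity)]
    linarith
  nlinarith [norm_nonneg (diskInv p)]

theorem two_div_smul_diskInv {p : ℂ} (hp : ‖p‖ < 1) :
    (2 / (1 + ‖diskInv p‖ ^ 2) : ℝ) • diskInv p = p := by
  rw [norm_diskInv_sq hp, diskInv, smul_smul]
  have hs := Real.sqrt_nonneg (1 - ‖p‖ ^ 2)
  set s := √(1 - ‖p‖ ^ 2)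
  have : 1 + s ≠ 0 := by positivity
  have h : 2 / (1 + (1 - s) / (1 + s)) * (1 + s)⁻¹ = 1 := by
    have h3 : 1 + (1 - s) / (1 + s) = 2 / (1 + s) := by field_simp; ring
    rw [h3]
    field_simp
  rw [h, one_smul]

theorem contDiffAt_diskInv {p : ℂ} (hp : ‖p‖ < 1) {m : WithTop ℕ∞} :
    ContDiffAt ℝ m diskInv p := by
  have h1 : 0 < 1 - ‖p‖ ^ 2 := by nlinarith [norm_nonneg p]
  have hs := Real.sqrt_nonneg (1 - ‖p‖ ^ 2)
  have h : ContDiffAt ℝ m (fun p : ℂ => 1 - ‖p‖ ^ 2) p :=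
    (contDiff_const.sub (contDiff_norm_sq ℝ)).contDiffAt
  exact ((contDiffAt_const.add (h.sqrt h1.ne')).inv (by positivity)).smul contDiffAt_id

/-- The tubular coordinates around the binding. -/
def tube (n : ℕ) (p : Cn n × ℂ) : Cn n := ((√(1 + ‖p.2‖ ^ 2))⁻¹ : ℝ) • (p.1 + p.2 • cj n p.1)

/-- The projection to the binding inverse to `tube`, given the disk coordinate `a`. -/
def untube (n : ℕ) (a : ℂ) (u : Cn n) : Cn n :=
  (√(1 + ‖a‖ ^ 2) / (1 - ‖a‖ ^ 2) : ℝ) • (u - a • cj n u)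

theorem P_real_smul (c : ℝ) (z : Cn n) : P n (c • z) = ((c ^ 2 : ℝ) : ℂ) * P n z := by
  rw [← Complex.coe_smul, P_smul, Complex.ofReal_pow]

theorem P_tube {b : Cn n} (hb : b ∈ K n ε) (w : ℂ) :
    P n (tube n (b, w)) = (ε ^ 2 : ℝ) • ((2 / (1 + ‖w‖ ^ 2) : ℝ) • w) := by
  simp only [tube]
  rw [P_real_smul, P_add_smul_cj, hb.2, mem_sphere_zero_iff_norm.1 hb.1, inv_pow,
    Real.sq_sqrt (by positivity)]
  simp only [Complex.real_smul, map_zero, mul_zero, zero_add, add_zero]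
  push_cast
  ring

theorem tube_mem_sphere (hε : 0 < ε) {b : Cn n} (hb : b ∈ K n ε) (w : ℂ) :
    tube n (b, w) ∈ Metric.sphere (0 : Cn n) ε := by
  have h := norm_add_smul_cj_sq w b
  rw [hb.2, mem_sphere_zero_iff_norm.1 hb.1] at h
  simp only [map_zero, mul_zero, add_zero] at h
  have h' : ‖b + w • cj n b‖ ^ 2 = (1 + ‖w‖ ^ 2) * ε ^ 2 := by exact_mod_cast h
  rw [← norm_sq_sub_eq_zero_iff hε, tube, norm_smul, mul_pow, h', Real.norm_eq_abs, sq_abs, inv_pow,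
    Real.sq_sqrt (by positivity), inv_mul_cancel_left₀ (by positivity), sub_self]

/-- With C(u) = a ū one has C² = |a|², so (1 + C)(1 - C) = 1 - |a|². Used with a and with -a, this
shows that `tube` and `untube` are mutually inverse. -/
theorem sub_smul_cj_add (a : ℂ) (u : Cn n) :
    (u - a • cj n u) + a • cj n (u - a • cj n u) = ((1 - ‖a‖ ^ 2 : ℝ) : ℂ) • u := by
  rw [map_sub, cj_smul, cj_cj, smul_sub, smul_smul, Complex.mul_conj', sub_add_sub_cancel]
  push_cast
  rw [sub_smul, one_smul]

theorem tube_untube {a : ℂ} (ha : ‖a‖ < 1) (u : Cn n) : tube n (untube n a u, a) = u := by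
  have h1 : 0 < 1 - ‖a‖ ^ 2 := by nlinarith [norm_nonneg a]
  have h2 : 0 < √(1 + ‖a‖ ^ 2) := Real.sqrt_pos.2 (by positivity)
  simp only [tube, untube]
  rw [map_smul, smul_comm a, ← smul_add, sub_smul_cj_add, Complex.coe_smul, smul_smul, smul_smul, mul_assoc]
  have : (√(1 + ‖a‖ ^ 2))⁻¹ * (√(1 + ‖a‖ ^ 2) / (1 - ‖a‖ ^ 2) * (1 - ‖a‖ ^ 2)) = 1 := by
    field_simp
  rw [this, one_smul]

theorem untube_tube {w : ℂ} (hw : ‖w‖ < 1) (b : Cn n) : untube n w (tube n (b, w)) = b := by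
  have h1 : 0 < 1 - ‖w‖ ^ 2 := by nlinarith [norm_nonneg w]
  have h2 : 0 < √(1 + ‖w‖ ^ 2) := Real.sqrt_pos.2 (by positivity)
  have h := sub_smul_cj_add (-w) b
  rw [neg_smul, neg_smul, sub_neg_eq_add, ← sub_eq_add_neg, norm_neg, Complex.coe_smul] at h
  simp only [tube, untube]
  rw [map_smul, smul_comm w, ← smul_sub, h, smul_smul, smul_smul, mul_assoc]
  have : √(1 + ‖w‖ ^ 2) / (1 - ‖w‖ ^ 2) * ((√(1 + ‖w‖ ^ 2))⁻¹ * (1 - ‖w‖ ^ 2)) = 1 := by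
    field_simp
  rw [this, one_smul]

theorem untube_mem_K (hε : 0 < ε) {a : ℂ} (ha : ‖a‖ < 1) {u : Cn n}
    (hu : u ∈ Metric.sphere (0 : Cn n) ε)
    (hP : P n u = (ε ^ 2 : ℝ) • ((2 / (1 + ‖a‖ ^ 2) : ℝ) • a)) : untube n a u ∈ K n ε := by
  have h1 : 0 < 1 - ‖a‖ ^ 2 := by nlinarith [norm_nonneg a]
  have h2 : 0 < 1 + ‖a‖ ^ 2 := by positivity
  have h2' : (1 + (‖a‖ : ℂ) ^ 2) ≠ 0 := by exact_mod_cast h2.ne'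
  have haa : a * conj a = (‖a‖ : ℂ) ^ 2 := Complex.mul_conj' a
  have hun := mem_sphere_zero_iff_norm.1 hu
  have hcP : conj (P n u) = (ε : ℂ) ^ 2 * (2 / (1 + (‖a‖ : ℂ) ^ 2) * conj a) := by
    rw [hP, Complex.real_smul, Complex.real_smul, map_mul, map_mul, Complex.conj_ofReal,
      Complex.conj_ofReal]
    push_cast
    rfl
  have hP' : P n u = (ε : ℂ) ^ 2 * (2 / (1 + (‖a‖ : ℂ) ^ 2) * a) := by
    rw [hP]; simp
  have hsub : u - a • cj n u = u + (-a) • cj n u := by rw [neg_smul, sub_eq_add_neg]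
  constructor
  · have h := norm_add_smul_cj_sq (-a) u
    have h3 : (‖u + (-a) • cj n u‖ : ℂ) ^ 2 =
        (ε : ℂ) ^ 2 * (1 - (‖a‖ : ℂ) ^ 2) ^ 2 / (1 + (‖a‖ : ℂ) ^ 2) := by
      rw [h, hcP, hP', norm_neg, hun, map_neg]
      field_simp
      linear_combination (-4 * (ε : ℂ) ^ 2) * haa
    have h4 : ‖u + (-a) • cj n u‖ ^ 2 = ε ^ 2 * (1 - ‖a‖ ^ 2) ^ 2 / (1 + ‖a‖ ^ 2) := by
      exact_mod_cast h3
    rw [← norm_sq_sub_eq_zero_iff hε, untube, norm_smul, mul_pow, hsub, h4, Real.norm_eq_abs,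
      sq_abs, div_pow, Real.sq_sqrt h2.le]
    field_simp
    ring
  · rw [untube, P_real_smul, hsub, P_add_smul_cj, hcP, hP', hun]
    have : (ε : ℂ) ^ 2 * (2 / (1 + (‖a‖ : ℂ) ^ 2) * a) + 2 * -a * (ε : ℂ) ^ 2 +
        (-a) ^ 2 * ((ε : ℂ) ^ 2 * (2 / (1 + (‖a‖ : ℂ) ^ 2) * conj a)) = 0 := by
      field_simp
      linear_combination (2 * (ε : ℂ) ^ 2 * a) * haa
    rw [this, mul_zero]

theorem Θ_tubular (hε : 0 < ε) :
    ∃ (O : Set (Cn n)) (Φ : Cn n × ℂ → Cn n), IsOpen O ∧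
      IsDiffeoOn Φ (K n ε ×ˢ Metric.ball (0 : ℂ) 1) (Metric.sphere (0 : Cn n) ε ∩ O) ∧
      (∀ b ∈ K n ε, Φ (b, 0) = b) ∧
      ∀ b ∈ K n ε, ∀ w ∈ Metric.ball (0 : ℂ) 1, w ≠ 0 →
        Φ (b, w) ∉ K n ε ∧ Θ n (Φ (b, w)) = w / (‖w‖ : ℂ) := by
  have hε2 : 0 < ε ^ 2 := by positivity
  have hdisk : ∀ u : Cn n, ‖P n u‖ < ε ^ 2 → ‖(ε ^ 2 : ℝ)⁻¹ • P n u‖ < 1 := fun u hu => by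
    rw [norm_smul, norm_inv, Real.norm_eq_abs, abs_of_pos hε2, inv_mul_lt_one₀ hε2]
    exact hu
  -- The map w ↦ 2w/(1+|w|²) takes the open disk onto itself, so by `P_tube` the tube fills exactly
  -- the part |P| < ε² of the sphere; w is recovered from P/ε² by `diskInv`.
  refine ⟨{u | ‖P n u‖ < ε ^ 2}, tube n,
    isOpen_lt (continuous_P n).norm continuous_const, ⟨?_, ?_, ?_⟩, fun b _ => by simp [tube], ?_⟩
  · refine ContDiff.contDiffOn (ContDiff.smul (ContDiff.inv (ContDiff.sqrt ?_ ?_) ?_) ?_)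
    · exact contDiff_const.add (contDiff_snd.norm_sq ℝ)
    · intro p; positivity
    · intro p
      exact (Real.sqrt_pos.2 (by positivity)).ne'
    · exact contDiff_fst.add (contDiff_snd.smul ((cj n).contDiff.comp contDiff_fst))
  · rintro ⟨b, w⟩ ⟨hb, hw⟩
    refine ⟨tube_mem_sphere hε hb w, ?_⟩
    change ‖P n (tube n (b, w))‖ < ε ^ 2
    rw [P_tube hb, norm_smul, Real.norm_eq_abs, abs_of_pos hε2]
    exact mul_lt_of_lt_one_right hε2 (norm_two_div_smul_lt (mem_ball_zero_iff.1 hw))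
  · refine ⟨fun u => (untube n (diskInv ((ε ^ 2 : ℝ)⁻¹ • P n u)) u,
      diskInv ((ε ^ 2 : ℝ)⁻¹ • P n u)), ?_, ?_, ?_, ?_⟩
    · rintro u ⟨-, hu⟩
      have hd : ContDiffAt ℝ ∞ (fun u => diskInv ((ε ^ 2 : ℝ)⁻¹ • P n u)) u :=
        (contDiffAt_diskInv (hdisk u hu)).comp u ((contDiff_P n).const_smul _).contDiffAt
      have ha := norm_diskInv_lt (hdisk u hu)
      refine ContDiffAt.contDiffWithinAt (ContDiffAt.prodMk (ContDiffAt.smul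
        (ContDiffAt.div (ContDiffAt.sqrt ?_ ?_) ?_ ?_) ?_) hd)
      · exact contDiffAt_const.add (hd.norm_sq ℝ)
      · positivity
      · exact contDiffAt_const.sub (hd.norm_sq ℝ)
      · nlinarith [norm_nonneg (diskInv ((ε ^ 2 : ℝ)⁻¹ • P n u))]
      · exact contDiffAt_id.sub (hd.smul (cj n).contDiff.contDiffAt)
    · rintro u ⟨huS, hu⟩
      have ha := norm_diskInv_lt (hdisk u hu)
      refine ⟨untube_mem_K hε ha huS ?_, mem_ball_zero_iff.2 ha⟩
      rw [two_div_smul_diskInv (hdisk u hu), smul_inv_smul₀ hε2.ne']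
    · rintro ⟨b, w⟩ ⟨hb, hw⟩
      have hw1 := mem_ball_zero_iff.1 hw
      simp only [P_tube hb, inv_smul_smul₀ hε2.ne', diskInv_two_div_smul hw1,
        untube_tube hw1]
    · rintro u ⟨-, hu⟩
      exact tube_untube (norm_diskInv_lt (hdisk u hu)) u
  · intro b hb w hw hw0
    have hr : 0 < ε ^ 2 * (2 / (1 + ‖w‖ ^ 2)) := by positivity
    obtain ⟨r, hr, hP⟩ : ∃ r : ℝ, 0 < r ∧ P n (tube n (b, w)) = r * w :=
      ⟨_, hr, by rw [P_tube hb, smul_smul, Complex.real_smul]⟩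
    have hr' : (r : ℂ) ≠ 0 := by exact_mod_cast hr.ne'
    refine ⟨fun h => mul_ne_zero hr' hw0 (hP.symm.trans h.2), ?_⟩
    rw [Θ, hP, norm_mul, Complex.norm_real, Real.norm_eq_abs, abs_of_pos hr, Complex.ofReal_mul,
      mul_div_mul_left _ _ hr']

theorem isOpenBook_milnor (hε : 0 < ε) :
    IsOpenBook (2 * n + 1) (Metric.sphere (0 : Cn (n + 1)) ε) (K (n + 1) ε) (Θ (n + 1)) where
  compact := isCompact_sphere _ _
  submanifold := isSubmanifold_sphere (n := n + 1) hε
  binding_subset := fun _ hz => hz.1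
  binding_closed := Metric.isClosed_sphere.inter (isClosed_eq (continuous_P _) continuous_const)
  binding_submanifold := isSubmanifold_K hε
  smooth := fun _ hz => (contDiffAt_Θ (P_ne_zero_of_mem hz)).contDiffWithinAt
  mapsTo := fun _ hz => mem_sphere_zero_iff_norm.2 (norm_Θ (P_ne_zero_of_mem hz))
  surjOn := Θ_surjOn hε
  locallyTrivial := Θ_locallyTrivial
  tubular := Θ_tubular hε

end OpenBook

end ContactOpenBook

end

theorem mainTheorem9 (n : ℕ) (hn : 1 ≤ n) (ε : ℝ) (hε : 0 < ε) :
    ContactOpenBook.CarriesKer (n - 1) (Metric.sphere (0 : ContactOpenBook.Cn n) ε)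
      (ContactOpenBook.K n ε) (ContactOpenBook.Θ n) (ContactOpenBook.α₀ n) := by
  -- For n ≥ 1 the truncated subtraction n - 1 is genuine, and the binding has dimension 2k + 1 = 2n
  -- - 1.
  obtain ⟨k, rfl⟩ : ∃ k, n = k + 1 := ⟨n - 1, by omega⟩
  rw [Nat.add_sub_cancel]
  exact
    { openBook := ContactOpenBook.isOpenBook_milnor hε
      contact := ContactOpenBook.isContactForm_sphere (n := k + 1) hε
      binding_contact := ContactOpenBook.isContactForm_K hε
      page_symplectic := fun t ht => ContactOpenBook.isSymplecticForm_page hε ht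
      orientation := fun t ht => ContactOpenBook.boundaryOrientationAgrees_page hε ht }
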